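/- **Theorem 2.** Let $s_1,s_2,\dots\in(0,\bar s]$ be group sizes; the $n$th society consists of groups $1,\dots,n$. A weight allocation is a Borel function $a:[0,\bar s]\to[0,\bar a]$, and group $i$ has weight $a_i=a(s_i)$. Preferences are independent within groups: the vote margin of group $i$ is $X_i=N_i/\sqrt{s_i}$, where $N_1,N_2,\dots$ are independent standard normal variables. Given a representation rule $r$, let $S=\sum_{i\le n}s_iX_i$ and $T=\sum_{i\le n}a_ir(X_i)$, let the decision be $D=\operatorname{sign}T$ if $T\ne0$ and the outcome of an independent fair $\pm1$ coin if $T=0$, and let welfare be $W=DS/\sigma$, where $\sigma$ is the standard deviation of $S$. The stochastic welfare order in the $n$th society is defined by $a\succsim b$ iff the law $H_a$ of $W$ under $a$ stochastically dominates the law $H_b$ under $b$, that is, $H_a((-\infty,x])\le H_b((-\infty,x])$ for all $x$. (i) Let $r(x)=\operatorname{sign}x$ (winner-take-all). Suppose that the empirical distribution of $s_1,\dots,s_n$ converges weakly, as $n\to\infty$, to a distribution $\Psi^*$ that is not degenerate at $0$. Consider the weight allocations $a$ that are not $\Psi^*$-almost everywhere zero and that are, at $\Psi^*$-almost every $s$,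 continuous along the group sizes (that is, for every $\varepsilon>0$ there is $\delta>0$ with $|a(s_i)-a(s)|<\varepsilon$ whenever $|s_i-s|<\delta$). For each of them the law of $W$ converges weakly to a nondegenerate law $H_a^*$, and for any two of them, $a$ and $b$, $$H^*_a\text{ stochastically dominates }H^*_b\iff c^*_{\rm sqrt}(a)\ge c^*_{\rm sqrt}(b),\qquad c^*_{\rm sqrt}(a)=\frac{\int\sqrt s\,a(s)\,d\Psi^*(s)}{\sqrt{\int s\,d\Psi^*(s)\int a(s)^2\,d\Psi^*(s)}}.$$ (ii) Let $r(x)=x$ (proportional representation). For every $n\ge1$ and all weight allocations $a$, $b$, neither of which vanishes at all of $s_1,\dots,s_n$, $$a\succsim b\iff\hat c_{\rm sqrt}(a)\ge\hat c_{\rm sqrt}(b),\qquad\hat c_{\rm sqrt}(a)=\frac{\sum_{i\le n}a_i}{\sqrt{\sum_{i\le n}s_i\,\sum_{i\le n}a_i^2/s_i}}.$$ Moreover, with $c=\hat c_{\rm sqrt}(a)$, the law of $W$ is exactly the skew normal distribution with density $2\phi(x)\Phi(\lambda x)$, $\lambda=c/\sqrt{1-c^2}$, where $\phi$ and $\Phi$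 are the standard normal density and distribution function; if $c=1$ (that is, $\lambda=\infty$) this means the law of $|N_1|$. -/

import Mathlib

open MeasureTheory ProbabilityTheory Filter Topology Set

noncomputable section

namespace VotingWelfare

/-! Group sizes are given by a sequence `s`; the `n`-th society consists of the first `n` groups.
A weight allocation is a function `a` of the group size, so group `i` has weight `a (s i)`. -/

/-- The distribution of group sizes in the society with `n ≥ 1` groups: the empirical measure of
`s 0, …, s (n - 1)`. -/
def sizeDist (s : ℕ → ℝ) (n : ℕ) [NeZero n] : ProbabilityMeasure ℝ :=
  ⟨(n : ENNReal)⁻¹ • ∑ i : Fin n, Measure.dirac (s i), ⟨by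
    have h : (n : ENNReal) ≠ 0 := by exact_mod_cast NeZero.ne n
    simp [Measure.smul_apply, Measure.finsetSum_apply,
      ENNReal.inv_mul_cancel h (ENNReal.natCast_ne_top n)]⟩⟩

/-- Weight allocations: Borel functions `[0, sbar] → [0, abar]` that are not almost everywhere
zero with respect to the distribution `μ` of group sizes. -/
structure IsWeightAllocation (sbar abar : ℝ) (μ : Measure ℝ) (a : ℝ → ℝ) : Prop where
  measurable : Measurable ((Icc 0 sbar).domRestrict a)
  mapsTo : MapsTo a (Icc 0 sbar) (Icc 0 abar)
  not_ae_zero : ¬ (∀ᵐ x ∂μ, a x = 0)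

/-- At almost every size `x` with respect to the limiting size distribution `μ`, the weights of
groups whose sizes tend to `x` tend to `a x`. -/
def AEContinuousAlong (s : ℕ → ℝ) (μ : Measure ℝ) (a : ℝ → ℝ) : Prop :=
  ∀ᵐ x ∂μ, ContinuousWithinAt a (range s) x

/-- A fair coin with values `1` and `-1`. -/
def coin : Measure ℝ :=
  (2 : ENNReal)⁻¹ • (Measure.dirac 1 + Measure.dirac (-1))

instance : IsProbabilityMeasure coin :=
  ⟨by simp [coin, ENNReal.inv_two_add_inv_two]⟩

/-- States of the world: a point is `(N, L)`, with one normal coordinate `N i` for each group and a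
tie-breaking coin `L`. -/
abbrev State (n : ℕ) : Type := (Fin n → ℝ) × ℝ

/-- The `N i` are independent standard normal, and independent of the fair coin `L`. -/
def stateLaw (n : ℕ) : Measure (State n) :=
  (Measure.pi fun _ : Fin n => gaussianReal 0 1).prod coin

instance (n : ℕ) : IsProbabilityMeasure (stateLaw n) := by
  unfold stateLaw; infer_instance

/-- The vote margin of group `i`. -/
def voteMargin (s : ℕ → ℝ) (n : ℕ) (i : Fin n) (ω : State n) : ℝ :=
  ω.1 i / √(s i)

/-- The total vote margin. -/
def totalVoteMargin (s : ℕ → ℝ) (n : ℕ) (ω : State n) : ℝ :=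
  ∑ i : Fin n, s i * voteMargin s n i ω

/-- The total weight margin under the representation rule `r`. -/
def totalWeightMargin (r : ℝ → ℝ) (s : ℕ → ℝ) (a : ℝ → ℝ) (n : ℕ) (ω : State n) : ℝ :=
  ∑ i : Fin n, a (s i) * r (voteMargin s n i ω)

/-- The social decision: the sign of the total weight margin, or the coin in case of a tie. -/
def decision (r : ℝ → ℝ) (s : ℕ → ℝ) (a : ℝ → ℝ) (n : ℕ) (ω : State n) : ℝ :=
  if totalWeightMargin r s a n ω = 0 then ω.2 else Real.sign (totalWeightMargin r s a n ω)

/-- Social welfare, normalized by the standard deviation of the total vote margin. -/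
def welfare (r : ℝ → ℝ) (s : ℕ → ℝ) (a : ℝ → ℝ) (n : ℕ) (ω : State n) : ℝ :=
  decision r s a n ω * totalVoteMargin s n ω / √(Var[totalVoteMargin s n; stateLaw n])

/-- The distribution of social welfare. -/
def welfareLaw (r : ℝ → ℝ) (s : ℕ → ℝ) (a : ℝ → ℝ) (n : ℕ) : Measure ℝ :=
  (stateLaw n).map (welfare r s a n)

/-- The rule "winner-take-all". -/
def winnerTakeAll (x : ℝ) : ℝ := Real.sign x

/-- The rule "proportional representation". -/
def proportionalRep (x : ℝ) : ℝ := x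

/-- `μ` stochastically dominates `ν`: its distribution function is nowhere larger. -/
def StochDominates (μ ν : Measure ℝ) : Prop :=
  ∀ x : ℝ, μ (Iic x) ≤ ν (Iic x)

/-- The stochastic welfare order `a ≿ b` in the society with `n` groups. -/
def WelfareGE (r : ℝ → ℝ) (s : ℕ → ℝ) (n : ℕ) (a b : ℝ → ℝ) : Prop :=
  StochDominates (welfareLaw r s a n) (welfareLaw r s b n)

/-- `H` is the limit in law of social welfare as the number of groups tends to infinity. -/
def IsLimitWelfareLaw (r : ℝ → ℝ) (s : ℕ → ℝ) (a : ℝ → ℝ) (H : ProbabilityMeasure ℝ) : Prop :=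
  TendstoInDistribution (fun n => welfare r s a n) atTop (id : ℝ → ℝ) stateLaw (H : Measure ℝ)

/-- The asymptotic stochastic welfare order: the (unique) limit law of welfare under `a`
stochastically dominates the one under `b`. -/
def AsympWelfareGE (r : ℝ → ℝ) (s : ℕ → ℝ) (a b : ℝ → ℝ) : Prop :=
  ∃ Ha Hb : ProbabilityMeasure ℝ, IsLimitWelfareLaw r s a Ha ∧ IsLimitWelfareLaw r s b Hb ∧
    StochDominates Ha Hb

/-- The asymptotic square-root cosine index. -/
def asympSqrtCosine (μ : Measure ℝ) (a : ℝ → ℝ) : ℝ :=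
  (∫ x, √x * a x ∂μ) / √((∫ x, x ∂μ) * ∫ x, a x ^ 2 ∂μ)

/-- The index for proportional representation in the society with `n` groups. -/
def propCosine (s : ℕ → ℝ) (n : ℕ) (a : ℝ → ℝ) : ℝ :=
  (∑ i : Fin n, a (s i)) / √((∑ i : Fin n, s i) * ∑ i : Fin n, a (s i) ^ 2 / s i)

/-- The skew normal distribution with parameter `l`: density `2 φ(x) Φ(l x)`. -/
def skewNormal (l : ℝ) : Measure ℝ :=
  volume.withDensity fun x =>
    ENNReal.ofReal (2 * gaussianPDFReal 0 1 x * cdf (gaussianReal 0 1) (l * x))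

/-- The half-normal distribution, which is the skew normal distribution with parameter `∞`. -/
def halfNormal : Measure ℝ :=
  (gaussianReal 0 1).map fun x => |x|

end VotingWelfare

end

/-! Welfare depends on two numbers only: `U = S/σ` and `V`, which is `T` scaled by a positive
factor. Off the line `V = 0` it equals `sign V * U`. If `(U, V)` is standard bivariate normal with
correlation `c` in `[0, 1]`, this variable has the law `signedLaw c`, so everything reduces to
finding `c` and to studying this one-parameter family.

The family: write `V = c U + √(1 - c²) Z` with `Z` independent of `U`. Symmetry under `(U, V) ↦ (-U,
-V)` gives `signedLaw c A = 2 P(V > 0, U ∈ A)`. With `U` and `Z` fixed, raising `c` shrinks this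
event where `U < 0` and enlarges it where `U > 0`, so the laws increase stochastically
(`signedLaw_mono`). Their means are `c E|N|`, so distinct `c` give distinct laws, and domination is
equivalent to `c ≤ c'` (`signedLaw_dominates_iff`). Conditioning on `U` gives the skew normal
density.

The correlation: under proportional representation `T` is linear in the `N i`, so `(U, V)` is
exactly normal and `c` is the cosine `propCosine`. Under winner-take-all `T = ∑ a_i sign N_i`; a
central limit theorem with coefficients of order `1/√n` (`tendsto_charFun_weightedPair_sign`) gives
a normal limit with correlation `E|N|` times the limiting cosine, because `E[N sign N] = E|N|`. The
positive factor `E|N|` does not affect the order. Ties have no effect in the limit, since the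
limiting pair does not charge `V = 0`.

Pairs are treated as complex numbers so that characteristic functions refer to the Euclidean plane.
-/

noncomputable section

namespace VotingWelfare

/-! ### The bivariate normal law with correlation `c` -/

/-- The standard normal law. -/
abbrev stdNormal : Measure ℝ := gaussianReal 0 1

instance : NullSingletonClass stdNormal := nullSingletonClass_gaussianReal one_ne_zero

/-- A pair with correlation `c`, as a complex number, built from two independent standard normal
variables. -/
def corrMap (c : ℝ) (p : ℝ × ℝ) : ℂ :=
  (p.1 : ℂ) + ((c * p.1 + √(1 - c ^ 2) * p.2 : ℝ) : ℂ) * Complex.I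

@[simp]
lemma corrMap_re (c : ℝ) (p : ℝ × ℝ) : (corrMap c p).re = p.1 := by
  simp [corrMap]

@[simp]
lemma corrMap_im (c : ℝ) (p : ℝ × ℝ) :
    (corrMap c p).im = c * p.1 + √(1 - c ^ 2) * p.2 := by
  simp [corrMap]

@[fun_prop]
lemma measurable_corrMap (c : ℝ) : Measurable (corrMap c) := by
  unfold corrMap; fun_prop

/-- The standard bivariate normal law with correlation `c`, as a measure on `ℂ`. -/
def corrLaw (c : ℝ) : Measure ℂ := (stdNormal.prod stdNormal).map (corrMap c)

instance (c : ℝ) : IsProbabilityMeasure (corrLaw c) :=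
  Measure.isProbabilityMeasure_map (by fun_prop)

lemma integral_exp_mul_I_stdNormal (t : ℝ) :
    ∫ x, Complex.exp (t * x * Complex.I) ∂stdNormal = Complex.exp (-(t ^ 2) / 2) := by
  rw [← charFun_apply_real, charFun_gaussianReal]
  congr 1
  push_cast
  ring

lemma charFun_corrLaw {c : ℝ} (hc : c ∈ Icc (0 : ℝ) 1) (t : ℂ) :
    charFun (corrLaw c) t =
      Complex.exp (-(t.re ^ 2 + 2 * c * t.re * t.im + t.im ^ 2 : ℝ) / 2) := by
  have hd : √(1 - c ^ 2) ^ 2 = 1 - c ^ 2 := Real.sq_sqrt (by nlinarith [hc.1, hc.2])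
  rw [charFun_apply, corrLaw, integral_map (by fun_prop) (by fun_prop)]
  have h : ∀ p : ℝ × ℝ, Complex.exp ((inner ℝ (corrMap c p) t : ℝ) * Complex.I) =
      Complex.exp ((t.re + c * t.im : ℝ) * p.1 * Complex.I) *
        Complex.exp ((√(1 - c ^ 2) * t.im : ℝ) * p.2 * Complex.I) := by
    intro p
    rw [← Complex.exp_add, Complex.inner, Complex.mul_re, Complex.conj_re, Complex.conj_im,
      corrMap_re, corrMap_im]
    congr 1
    push_cast
    ring
  simp_rw [h]
  rw [integral_prod_mul (fun x : ℝ => Complex.exp ((t.re + c * t.im : ℝ) * x * Complex.I))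
    (fun x : ℝ => Complex.exp ((√(1 - c ^ 2) * t.im : ℝ) * x * Complex.I)),
    integral_exp_mul_I_stdNormal, integral_exp_mul_I_stdNormal, ← Complex.exp_add]
  congr 1
  norm_cast
  rw [mul_pow, hd]
  ring

lemma eq_corrLaw_of_charFun {c : ℝ} (hc : c ∈ Icc (0 : ℝ) 1) {μ : Measure ℂ} [IsFiniteMeasure μ]
    (h : ∀ t : ℂ, charFun μ t =
      Complex.exp (-(t.re ^ 2 + 2 * c * t.re * t.im + t.im ^ 2 : ℝ) / 2)) : μ = corrLaw c :=
  Measure.ext_of_charFun (funext fun t => (h t).trans (charFun_corrLaw hc t).symm)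

/-- This symmetry and the next are read off from the quadratic form in the characteristic function.
Negation produces the factor 2 in `signedLaw_apply`; the swap allows the independent decomposition
to start from `V` instead of `U`. -/
lemma map_neg_corrLaw {c : ℝ} (hc : c ∈ Icc (0 : ℝ) 1) :
    (corrLaw c).map (fun z => -z) = corrLaw c := by
  refine eq_corrLaw_of_charFun hc fun t => ?_
  rw [charFun_apply, integral_map (by fun_prop) (by fun_prop)]
  have : ∀ z : ℂ, inner ℝ (-z) t = inner ℝ z (-t) := by intro z; simp
  simp_rw [this]
  rw [← charFun_apply, charFun_corrLaw hc]
  simp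

lemma map_swap_corrLaw {c : ℝ} (hc : c ∈ Icc (0 : ℝ) 1) :
    (corrLaw c).map (fun z => (z.im : ℂ) + z.re * Complex.I) = corrLaw c := by
  refine eq_corrLaw_of_charFun hc fun t => ?_
  rw [charFun_apply, integral_map (by fun_prop) (by fun_prop)]
  have : ∀ z : ℂ, inner ℝ ((z.im : ℂ) + z.re * Complex.I) t =
      inner ℝ z ((t.im : ℂ) + t.re * Complex.I) := by
    intro z; simp [Complex.inner]; ring
  simp_rw [this]
  rw [← charFun_apply, charFun_corrLaw hc]
  congr 2
  simp
  ring

lemma map_re_corrLaw (c : ℝ) : (corrLaw c).map Complex.re = stdNormal := by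
  rw [corrLaw, Measure.map_map (by fun_prop) (by fun_prop)]
  have : Complex.re ∘ corrMap c = Prod.fst := by ext p; simp
  rw [this, Measure.map_fst_prod]
  simp

lemma map_im_corrLaw {c : ℝ} (hc : c ∈ Icc (0 : ℝ) 1) :
    (corrLaw c).map Complex.im = stdNormal := by
  conv_lhs => rw [← map_swap_corrLaw hc]
  rw [Measure.map_map (by fun_prop) (by fun_prop), ← map_re_corrLaw c]
  congr 1
  ext z
  simp

lemma corrLaw_re_eq (c x : ℝ) : corrLaw c {z | z.re = x} = 0 := by
  have h := measure_singleton (μ := stdNormal) x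
  rwa [← map_re_corrLaw c, Measure.map_apply (by fun_prop) (measurableSet_singleton x)] at h

lemma corrLaw_im_eq {c : ℝ} (hc : c ∈ Icc (0 : ℝ) 1) (x : ℝ) :
    corrLaw c {z | z.im = x} = 0 := by
  have h := measure_singleton (μ := stdNormal) x
  rwa [← map_im_corrLaw hc, Measure.map_apply (by fun_prop) (measurableSet_singleton x)] at h

lemma corrLaw_ae_im_ne {c : ℝ} (hc : c ∈ Icc (0 : ℝ) 1) : ∀ᵐ z ∂corrLaw c, z.im ≠ 0 := by
  rw [ae_iff]
  simpa using corrLaw_im_eq hc 0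

/-! ### The law of `sign V * U` for a pair `(U, V)` with correlation `c` -/

/-- The real part, with its sign flipped on the lower half-plane. -/
def signedRe (z : ℂ) : ℝ := if 0 ≤ z.im then z.re else -z.re

@[fun_prop]
lemma measurable_signedRe : Measurable signedRe :=
  Measurable.ite (measurableSet_le measurable_const Complex.measurable_im) (by fun_prop)
    (by fun_prop)

/-- The law of `sign V * U`, where `(U, V)` is standard bivariate normal with correlation `c`. -/
def signedLaw (c : ℝ) : Measure ℝ := (corrLaw c).map signedRe

instance (c : ℝ) : IsProbabilityMeasure (signedLaw c) :=
  Measure.isProbabilityMeasure_map (by fun_prop)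

/-- The event splits into an upper and a lower half-plane part, exchanged by `z ↦ -z` and hence of
equal mass; the real axis is null. -/
lemma signedLaw_apply {c : ℝ} (hc : c ∈ Icc (0 : ℝ) 1) {A : Set ℝ} (hA : MeasurableSet A) :
    signedLaw c A = 2 * corrLaw c {z | 0 < z.im ∧ z.re ∈ A} := by
  have hup : MeasurableSet {z : ℂ | 0 < z.im ∧ z.re ∈ A} :=
    (measurableSet_lt measurable_const Complex.measurable_im).inter (Complex.measurable_re hA)
  have hdn : MeasurableSet {z : ℂ | z.im < 0 ∧ -z.re ∈ A} :=
    (measurableSet_lt Complex.measurable_im measurable_const).inter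
      (Complex.measurable_re.neg hA)
  have h1 : corrLaw c {z | z.im < 0 ∧ -z.re ∈ A} = corrLaw c {z | 0 < z.im ∧ z.re ∈ A} := by
    conv_rhs => rw [← map_neg_corrLaw hc]
    rw [Measure.map_apply (by fun_prop) hup]
    simp
  have h2 : signedRe ⁻¹' A =ᵐ[corrLaw c]
      ({z : ℂ | 0 < z.im ∧ z.re ∈ A} ∪ {z : ℂ | z.im < 0 ∧ -z.re ∈ A} : Set ℂ) := by
    filter_upwards [corrLaw_ae_im_ne hc] with z hz
    apply propext
    change signedRe z ∈ A ↔ (0 < z.im ∧ z.re ∈ A) ∨ (z.im < 0 ∧ -z.re ∈ A)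
    rcases lt_or_gt_of_ne hz with h | h
    · simp [signedRe, h, h.not_ge, h.not_gt]
    · simp [signedRe, h, h.le, h.not_gt]
  rw [signedLaw, Measure.map_apply measurable_signedRe hA, measure_congr h2,
    measure_union _ hdn, h1, two_mul]
  rw [Set.disjoint_left]
  rintro z ⟨h, -⟩ ⟨h', -⟩
  exact lt_asymm h h'

lemma signedLaw_apply_prod {c : ℝ} (hc : c ∈ Icc (0 : ℝ) 1) {A : Set ℝ} (hA : MeasurableSet A) :
    signedLaw c A =
      2 * (stdNormal.prod stdNormal) {p | 0 < c * p.1 + √(1 - c ^ 2) * p.2 ∧ p.1 ∈ A} := by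
  have hup : MeasurableSet {z : ℂ | 0 < z.im ∧ z.re ∈ A} :=
    (measurableSet_lt measurable_const Complex.measurable_im).inter (Complex.measurable_re hA)
  rw [signedLaw_apply hc hA, corrLaw, Measure.map_apply (by fun_prop) hup]
  simp

/-- Both laws are realized on the same independent pair. Passing from `c` to `c'` raises the
coefficient of `p.1` and lowers that of `p.2`. If `p.1 ≤ 0`, positivity of the combination forces
`p.2 ≥ 0`, so the `c'`-event lies in the `c`-event; if `p.1 > 0` the inclusion is reversed, which is
why upper tails are compared for `x > 0`. -/
lemma signedLaw_mono {c c' : ℝ} (hc : 0 ≤ c) (hcc' : c ≤ c') (hc' : c' ≤ 1) :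
    StochDominates (signedLaw c') (signedLaw c) := by
  have m : c ∈ Icc (0 : ℝ) 1 := ⟨hc, hcc'.trans hc'⟩
  have m' : c' ∈ Icc (0 : ℝ) 1 := ⟨hc.trans hcc', hc'⟩
  have hd : √(1 - c' ^ 2) ≤ √(1 - c ^ 2) := Real.sqrt_le_sqrt (by nlinarith)
  have hd0 := Real.sqrt_nonneg (1 - c' ^ 2)
  intro x
  rcases le_or_gt x 0 with hx | hx
  · rw [signedLaw_apply_prod m measurableSet_Iic, signedLaw_apply_prod m' measurableSet_Iic]
    refine mul_le_mul_right (measure_mono ?_) 2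
    rintro p ⟨h, h'⟩
    refine ⟨?_, h'⟩
    have hp : p.1 ≤ 0 := le_trans h' hx
    have hv : 0 ≤ p.2 := by
      by_contra! hv
      nlinarith [mul_nonneg (hd0.trans hd) (neg_nonneg.2 hv.le), mul_nonneg hc (neg_nonneg.2 hp)]
    nlinarith
  · have key : signedLaw c (Ioi x) ≤ signedLaw c' (Ioi x) := by
      rw [signedLaw_apply_prod m measurableSet_Ioi, signedLaw_apply_prod m' measurableSet_Ioi]
      refine mul_le_mul_right (measure_mono ?_) 2
      rintro p ⟨h, h'⟩
      refine ⟨?_, h'⟩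
      have hp : 0 < p.1 := lt_trans hx h'
      rcases le_or_gt p.2 0 with hv | hv
      · nlinarith
      · rcases eq_or_lt_of_le (hc.trans hcc') with h0 | h0
        · have : c = 0 := le_antisymm (by linarith) hc
          subst h0; subst this; exact h
        · have := mul_pos h0 hp
          have := mul_nonneg hd0 hv.le
          linarith
    rw [← compl_Ioi, prob_compl_eq_one_sub measurableSet_Ioi,
      prob_compl_eq_one_sub measurableSet_Ioi]
    exact tsub_le_tsub_left key 1

/-- The first absolute moment of the standard normal law. -/
def absMoment : ℝ := ∫ x, |x| ∂stdNormal

lemma memLp_id_stdNormal (p : ENNReal) (hp : p ≠ ⊤) : MemLp (fun x : ℝ => x) p stdNormal :=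
  memLp_id_gaussianReal' p hp

lemma integrable_id_stdNormal : Integrable (fun x : ℝ => x) stdNormal :=
  (memLp_id_stdNormal 1 (by simp)).integrable le_rfl

lemma integrable_sq_stdNormal : Integrable (fun x : ℝ => x ^ 2) stdNormal :=
  (memLp_id_stdNormal 2 (by simp)).integrable_sq

lemma integral_sq_stdNormal : ∫ x, x ^ 2 ∂stdNormal = 1 := by
  have h := variance_fun_id_gaussianReal (μ := 0) (v := 1)
  rw [variance_eq_integral (by fun_prop)] at h
  simpa using h

lemma absMoment_pos : 0 < absMoment := by
  rw [absMoment, integral_pos_iff_support_of_nonneg (fun _ => abs_nonneg _)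
    integrable_id_stdNormal.abs]
  have : Function.support (fun x : ℝ => |x|) = {0}ᶜ := by ext; simp
  rw [this, prob_compl_eq_one_sub (measurableSet_singleton _)]
  simp

/-- Keeps the limiting winner-take-all correlation within `[0, 1]`. -/
lemma absMoment_le_one : absMoment ≤ 1 := by
  have h : absMoment ≤ ∫ x, (1 + x ^ 2) / 2 ∂stdNormal := by
    refine integral_mono integrable_id_stdNormal.abs
      (((integrable_const 1).add integrable_sq_stdNormal).div_const 2) fun x => ?_
    dsimp
    nlinarith [sq_nonneg (|x| - 1), sq_abs x]
  rw [integral_div, integral_add (integrable_const 1) integrable_sq_stdNormal,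
    integral_sq_stdNormal] at h
  simpa using h

/-- After the swap, `V = p.1` and `U = c * p.1 + √(1 - c²) * p.2`, so `sign V * U` is `c * |p.1|`
plus a term whose mean vanishes by independence. -/
lemma integral_signedLaw {c : ℝ} (hc : c ∈ Icc (0 : ℝ) 1) :
    ∫ x, x ∂signedLaw c = c * absMoment := by
  rw [signedLaw, integral_map (by fun_prop) (by fun_prop), ← map_swap_corrLaw hc,
    integral_map (by fun_prop) (by fun_prop), corrLaw, integral_map (by fun_prop)]
  · have h : ∀ p : ℝ × ℝ, signedRe (((corrMap c p).im : ℂ) + (corrMap c p).re * Complex.I) =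
        (c * |p.1|) * 1 + (√(1 - c ^ 2) * if 0 ≤ p.1 then 1 else -1) * p.2 := by
      intro p
      by_cases hp : 0 ≤ p.1
      · simp [signedRe, hp, abs_of_nonneg hp]
      · simp [signedRe, hp, abs_of_neg (not_le.1 hp)]; ring
    simp_rw [h]
    have hi : Integrable (fun x : ℝ => √(1 - c ^ 2) * if 0 ≤ x then (1 : ℝ) else -1)
        stdNormal := by
      refine Integrable.const_mul (Integrable.of_bound (C := 1) ?_ (ae_of_all _ fun x => ?_)) _
      · exact (Measurable.ite measurableSet_Ici measurable_const
          measurable_const).aestronglyMeasurable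
      · split_ifs <;> simp
    rw [integral_add, integral_prod_mul (fun x : ℝ => c * |x|) (fun _ : ℝ => (1 : ℝ)),
      integral_prod_mul (fun x : ℝ => √(1 - c ^ 2) * if 0 ≤ x then (1 : ℝ) else -1)
        (fun y : ℝ => y), integral_const_mul]
    · simp [absMoment]
    · exact (integrable_id_stdNormal.abs.const_mul c).mul_prod (integrable_const 1)
    · exact hi.mul_prod integrable_id_stdNormal
  · exact Measurable.aestronglyMeasurable (by fun_prop)

/-- If `c' < c`, monotonicity would make the domination mutual, so the laws and hence their means
would agree. -/
lemma signedLaw_dominates_iff {c c' : ℝ} (hc : c ∈ Icc (0 : ℝ) 1) (hc' : c' ∈ Icc (0 : ℝ) 1) :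
    StochDominates (signedLaw c') (signedLaw c) ↔ c ≤ c' := by
  refine ⟨fun h => ?_, fun h => signedLaw_mono hc.1 h hc'.2⟩
  by_contra! hlt
  have h' := signedLaw_mono hc'.1 hlt.le hc.2
  have heq : signedLaw c = signedLaw c' :=
    Measure.ext_of_Iic _ _ fun x => le_antisymm (h' x) (h x)
  have := integral_signedLaw hc
  rw [heq, integral_signedLaw hc'] at this
  exact hlt.ne (mul_right_cancel₀ absMoment_pos.ne' this)

lemma signedLaw_ne_dirac {c : ℝ} (hc : c ∈ Icc (0 : ℝ) 1) (x : ℝ) :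
    signedLaw c ≠ Measure.dirac x := by
  intro h
  have h1 : signedLaw c {x} = 1 := by simp [h]
  rw [signedLaw_apply hc (measurableSet_singleton x)] at h1
  have h0 : corrLaw c {z | 0 < z.im ∧ z.re ∈ ({x} : Set ℝ)} = 0 :=
    measure_mono_null (fun z hz => hz.2) (corrLaw_re_eq c x)
  rw [h0] at h1
  simp at h1

lemma stdNormal_Ioi_neg (x : ℝ) : stdNormal (Ioi (-x)) = stdNormal (Iic x) := by
  have h : stdNormal.map (fun x => -x) = stdNormal := by
    simpa using gaussianReal_map_neg (μ := 0) (v := 1)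
  conv_lhs => rw [← h]
  rw [Measure.map_apply (by fun_prop) measurableSet_Ioi]
  have : (fun x : ℝ => -x) ⁻¹' Ioi (-x) = Iio x := by ext; simp
  rw [this, measure_congr Iio_ae_eq_Iic]

/-- Given `U = x`, the event `V > 0` says that `Z` exceeds `-(c / √(1 - c²)) * x`; by symmetry of
`Z` its probability is the normal distribution function at `l * x`. -/
lemma signedLaw_eq_skewNormal {c : ℝ} (hc : 0 ≤ c) (hc1 : c < 1) :
    signedLaw c = skewNormal (c / √(1 - c ^ 2)) := by
  have hd : 0 < √(1 - c ^ 2) := Real.sqrt_pos.2 (by nlinarith)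
  ext A hA
  have hmeas : MeasurableSet {p : ℝ × ℝ | 0 < c * p.1 + √(1 - c ^ 2) * p.2 ∧ p.1 ∈ A} :=
    (measurableSet_lt (f := fun _ : ℝ × ℝ => (0 : ℝ))
      (g := fun p : ℝ × ℝ => c * p.1 + √(1 - c ^ 2) * p.2) (by fun_prop) (by fun_prop)).inter
      (measurable_fst hA)
  have hw : ∀ f : ℝ → ENNReal, Measurable f →
      ∫⁻ x, f x ∂stdNormal = ∫⁻ x, gaussianPDF 0 1 x * f x := by
    intro f hf
    rw [stdNormal, gaussianReal_of_var_ne_zero 0 one_ne_zero,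
      lintegral_withDensity_eq_lintegral_mul _ (by fun_prop) hf]
    rfl
  rw [signedLaw_apply_prod ⟨hc, hc1.le⟩ hA, Measure.prod_apply hmeas, skewNormal,
    withDensity_apply _ hA, ← lintegral_const_mul' _ _ (by simp),
    hw _ ((measurable_measure_prodMk_left hmeas).const_mul 2), ← lintegral_indicator hA]
  refine lintegral_congr fun x => ?_
  by_cases hx : x ∈ A
  · have hs : Prod.mk x ⁻¹' {p : ℝ × ℝ | 0 < c * p.1 + √(1 - c ^ 2) * p.2 ∧ p.1 ∈ A} =
        Ioi (-(c / √(1 - c ^ 2) * x)) := by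
      ext y
      simp only [mem_preimage, mem_ofPred_eq, hx, and_true, mem_Ioi]
      rw [show -(c / √(1 - c ^ 2) * x) = (-(c * x)) / √(1 - c ^ 2) by ring, div_lt_iff₀ hd]
      constructor <;> intro h <;> linarith
    have hp := gaussianPDFReal_nonneg 0 1 x
    rw [hs, indicator_of_mem hx, stdNormal_Ioi_neg, ENNReal.ofReal_mul (by positivity),
      ENNReal.ofReal_mul zero_le_two, ofReal_cdf, gaussianPDF, ENNReal.ofReal_ofNat]
    ring
  · simp [hx]

lemma signedLaw_one : signedLaw 1 = halfNormal := by
  rw [signedLaw, corrLaw, Measure.map_map (by fun_prop) (by fun_prop), halfNormal]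
  have : signedRe ∘ corrMap 1 = (fun x : ℝ => |x|) ∘ Prod.fst := by
    ext p
    by_cases hp : 0 ≤ p.1
    · simp [signedRe, hp, abs_of_nonneg hp]
    · simp [signedRe, hp, abs_of_neg (not_le.1 hp)]
  rw [this, ← Measure.map_map (by fun_prop) (by fun_prop), Measure.map_fst_prod]
  simp

/-! ### A central limit theorem for weighted sums of normal variables and their signs -/

/-- The exponential remainder serves `|y| ≤ 1`, the triangle inequality `|y| > 1`; the constant 4 is
large enough for both. -/
lemma norm_exp_mul_I_sub_taylor_le (y : ℝ) :
    ‖Complex.exp (y * Complex.I) - (1 + y * Complex.I - y ^ 2 / 2)‖ ≤ 4 * |y| ^ 3 := by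
  have hn : ‖(y : ℂ) * Complex.I‖ = |y| := by simp
  rcases le_or_gt |y| 1 with hy | hy
  · have h := Complex.exp_bound (x := y * Complex.I) (by rwa [hn]) (n := 3) (by norm_num)
    rw [hn] at h
    have hs : ∑ m ∈ Finset.range 3, ((y : ℂ) * Complex.I) ^ m / (m.factorial : ℂ) =
        1 + y * Complex.I - y ^ 2 / 2 := by
      simp [Finset.sum_range_succ, mul_pow]
      ring
    rw [hs] at h
    refine h.trans ?_
    rw [mul_comm]
    gcongr
    norm_num [Nat.factorial]
  · have h1 : ‖Complex.exp (y * Complex.I)‖ = 1 := Complex.norm_exp_ofReal_mul_I y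
    have h2 : ‖(1 + y * Complex.I - y ^ 2 / 2 : ℂ)‖ ≤ 1 + |y| + |y| ^ 2 / 2 := by
      refine (norm_sub_le _ _).trans (add_le_add ((norm_add_le _ _).trans ?_) ?_)
      · rw [hn]; simp
      · simp
    refine (norm_sub_le _ _).trans ?_
    nlinarith [mul_pos (sub_pos.2 hy) (sub_pos.2 hy), pow_pos (sub_pos.2 hy) 3]

lemma abs_exp_neg_sub_le {u : ℝ} (hu : 0 ≤ u) : |Real.exp (-u) - (1 - u)| ≤ u ^ 2 := by
  rcases le_or_gt u 1 with h | h
  · have := Real.abs_exp_sub_one_sub_id_le (x := -u) (by rwa [abs_neg, abs_of_nonneg hu])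
    rwa [neg_sq, show Real.exp (-u) - 1 - -u = Real.exp (-u) - (1 - u) by ring] at this
  · have h1 : Real.exp (-u) ≤ 1 := Real.exp_le_one_iff.2 (by linarith)
    have h2 := Real.exp_pos (-u)
    rw [abs_le]
    constructor <;> nlinarith

lemma integrable_one_add_abs_pow (k : ℕ) :
    Integrable (fun x : ℝ => (1 + |x|) ^ k) stdNormal := by
  have h1 : MemLp (fun x : ℝ => |x|) (k : ENNReal) stdNormal :=
    (memLp_id_stdNormal k (ENNReal.natCast_ne_top k)).abs
  have h2 : MemLp (fun _ : ℝ => (1 : ℝ)) (k : ENNReal) stdNormal := memLp_const 1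
  have h : MemLp (fun x : ℝ => 1 + |x|) (k : ENNReal) stdNormal := h2.add h1
  refine (h.integrable_norm_pow').congr (ae_of_all _ fun x => ?_)
  dsimp
  rw [abs_of_nonneg (by positivity)]

/-- The third moment of `1 + |x|` under the standard normal law. -/
def thirdMoment : ℝ := ∫ x, (1 + |x|) ^ 3 ∂stdNormal

/-- One factor of the central limit theorem. Both terms are compared with `1 - v / 2`: the first by
Taylor expansion, where the zero mean removes the linear term, the second through `v ≤ M² *
thirdMoment` and `M⁴ ≤ M³`. -/
lemma norm_integral_exp_sub_le {Y : ℝ → ℝ} (hY : Measurable Y) {M : ℝ} (hM1 : M ≤ 1)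
    (hbound : ∀ x, |Y x| ≤ M * (1 + |x|)) (hmean : ∫ x, Y x ∂stdNormal = 0) :
    ‖∫ x, Complex.exp (Y x * Complex.I) ∂stdNormal -
      Complex.exp (-(∫ x, Y x ^ 2 ∂stdNormal : ℝ) / 2)‖ ≤
      (4 * thirdMoment + thirdMoment ^ 2) * M ^ 3 := by
  have hM : 0 ≤ M := by simpa using (abs_nonneg _).trans (hbound 0)
  have hYi : Integrable Y stdNormal :=
    ((integrable_one_add_abs_pow 1).const_mul M).mono' hY.aestronglyMeasurable
      (ae_of_all _ fun x => by simpa using hbound x)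
  have hsq : ∀ x, Y x ^ 2 ≤ M ^ 2 * (1 + |x|) ^ 2 := fun x => by
    rw [← mul_pow, ← sq_abs]; exact pow_le_pow_left₀ (abs_nonneg _) (hbound x) 2
  have hY2i : Integrable (fun x => Y x ^ 2) stdNormal :=
    ((integrable_one_add_abs_pow 2).const_mul (M ^ 2)).mono'
      (hY.pow_const 2).aestronglyMeasurable
      (ae_of_all _ fun x => by simpa using hsq x)
  set v := ∫ x, Y x ^ 2 ∂stdNormal with hv
  have hv0 : 0 ≤ v := integral_nonneg fun x => sq_nonneg _
  have hC0 : 0 ≤ thirdMoment := integral_nonneg fun x => by positivity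
  have hvle : v ≤ M ^ 2 * thirdMoment := by
    rw [hv, thirdMoment, ← integral_const_mul]
    refine integral_mono hY2i ((integrable_one_add_abs_pow 3).const_mul _) fun x => ?_
    refine (hsq x).trans (mul_le_mul_of_nonneg_left ?_ (sq_nonneg M))
    exact pow_le_pow_right₀ (by linarith [abs_nonneg x]) (by norm_num)
  have hexpi : Integrable (fun x => Complex.exp (Y x * Complex.I)) stdNormal :=
    Integrable.of_bound (C := 1)
      (Measurable.aestronglyMeasurable (by fun_prop))
      (ae_of_all _ fun x => (Complex.norm_exp_ofReal_mul_I _).le)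
  have hlin : Integrable (fun x => (1 : ℂ) + Y x * Complex.I) stdNormal :=
    (integrable_const 1).add (hYi.ofReal.mul_const _)
  have hquad : Integrable (fun x => (Y x : ℂ) ^ 2 / 2) stdNormal := by
    have := (hY2i.ofReal (𝕜 := ℂ)).div_const 2
    simpa using this
  have htaylor : ∫ x, ((1 : ℂ) + Y x * Complex.I - (Y x : ℂ) ^ 2 / 2) ∂stdNormal =
      ((1 - v / 2 : ℝ) : ℂ) := by
    have e1 : ∫ x, (Y x : ℂ) ∂stdNormal = 0 := by rw [integral_complex_ofReal, hmean]; simp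
    have e2 : ∫ x, (Y x : ℂ) ^ 2 ∂stdNormal = v := by
      rw [hv, ← integral_complex_ofReal]; simp
    rw [integral_sub hlin hquad, integral_add (integrable_const 1) (hYi.ofReal.mul_const _),
      integral_mul_const, integral_div, e1, e2]
    simp
  have htayi : Integrable (fun x => (1 : ℂ) + Y x * Complex.I - (Y x : ℂ) ^ 2 / 2) stdNormal :=
    hlin.sub hquad
  have h1 : ‖∫ x, Complex.exp (Y x * Complex.I) ∂stdNormal - ((1 - v / 2 : ℝ) : ℂ)‖ ≤
      4 * thirdMoment * M ^ 3 := by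
    rw [← htaylor, ← integral_sub hexpi htayi]
    have e : 4 * thirdMoment * M ^ 3 = ∫ x, 4 * M ^ 3 * (1 + |x|) ^ 3 ∂stdNormal := by
      rw [integral_const_mul, thirdMoment]; ring
    rw [e]
    refine norm_integral_le_of_norm_le ((integrable_one_add_abs_pow 3).const_mul _)
      (ae_of_all _ fun x => (norm_exp_mul_I_sub_taylor_le (Y x)).trans ?_)
    rw [mul_assoc, ← mul_pow]
    gcongr
    exact hbound x
  have h2 : ‖((1 - v / 2 : ℝ) : ℂ) - Complex.exp (-(v : ℝ) / 2)‖ ≤ thirdMoment ^ 2 * M ^ 3 := by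
    have e : Complex.exp (-(v : ℝ) / 2) = (Real.exp (-(v / 2)) : ℂ) := by
      push_cast; congr 1; ring
    rw [e, ← Complex.ofReal_sub, Complex.norm_real, Real.norm_eq_abs, abs_sub_comm]
    refine (abs_exp_neg_sub_le (by positivity)).trans ?_
    have h3 : v ^ 2 ≤ (M ^ 2 * thirdMoment) ^ 2 := pow_le_pow_left₀ hv0 hvle 2
    have h4 : M ^ 4 ≤ M ^ 3 := pow_le_pow_of_le_one hM hM1 (by norm_num)
    nlinarith [mul_le_mul_of_nonneg_left h4 (sq_nonneg thirdMoment), sq_nonneg v]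
  calc _ = ‖(∫ x, Complex.exp (Y x * Complex.I) ∂stdNormal - ((1 - v / 2 : ℝ) : ℂ)) +
        (((1 - v / 2 : ℝ) : ℂ) - Complex.exp (-(v : ℝ) / 2))‖ := by congr 1; ring
    _ ≤ _ := norm_add_le _ _
    _ ≤ _ := by linarith

/-- Factors are replaced one at a time, the remaining ones having modulus at most 1. -/
lemma norm_prod_sub_prod_le_sum {ι : Type*} (S : Finset ι) (f g : ι → ℂ)
    (hf : ∀ i, ‖f i‖ ≤ 1) (hg : ∀ i, ‖g i‖ ≤ 1) :
    ‖∏ i ∈ S, f i - ∏ i ∈ S, g i‖ ≤ ∑ i ∈ S, ‖f i - g i‖ := by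
  classical
  induction S using Finset.induction_on with
  | empty => simp
  | insert a S ha ih =>
    rw [Finset.prod_insert ha, Finset.prod_insert ha, Finset.sum_insert ha]
    have hp : ‖∏ i ∈ S, f i‖ ≤ 1 := by
      rw [norm_prod]; exact Finset.prod_le_one (fun i _ => norm_nonneg _) fun i _ => hf i
    calc _ = ‖(f a - g a) * ∏ i ∈ S, f i + g a * (∏ i ∈ S, f i - ∏ i ∈ S, g i)‖ := by
          congr 1; ring
      _ ≤ ‖f a - g a‖ * ‖∏ i ∈ S, f i‖ + ‖g a‖ * ‖∏ i ∈ S, f i - ∏ i ∈ S, g i‖ := by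
          rw [← norm_mul, ← norm_mul]; exact norm_add_le _ _
      _ ≤ ‖f a - g a‖ * 1 + 1 * ∑ i ∈ S, ‖f i - g i‖ := by
          gcongr
          exact hg a
      _ = _ := by ring

/-- The pair of weighted sums `∑ p i * N i` and `∑ q i * h (N i)`, as a complex number. -/
def weightedPair (h : ℝ → ℝ) {n : ℕ} (p q : Fin n → ℝ) (ω : State n) : ℂ :=
  ((∑ i, p i * ω.1 i : ℝ) : ℂ) + ((∑ i, q i * h (ω.1 i) : ℝ) : ℂ) * Complex.I

@[simp]
lemma weightedPair_re (h : ℝ → ℝ) {n : ℕ} (p q : Fin n → ℝ) (ω : State n) :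
    (weightedPair h p q ω).re = ∑ i, p i * ω.1 i := by
  simp only [weightedPair, Complex.add_re, Complex.ofReal_re, Complex.re_ofReal_mul,
    Complex.I_re, mul_zero, add_zero]

@[simp]
lemma weightedPair_im (h : ℝ → ℝ) {n : ℕ} (p q : Fin n → ℝ) (ω : State n) :
    (weightedPair h p q ω).im = ∑ i, q i * h (ω.1 i) := by
  simp only [weightedPair, Complex.add_im, Complex.ofReal_im, Complex.im_ofReal_mul,
    Complex.I_im, mul_one, zero_add]

lemma measurable_weightedPair {h : ℝ → ℝ} (hh : Measurable h) {n : ℕ} (p q : Fin n → ℝ) :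
    Measurable (weightedPair h p q) := by
  unfold weightedPair; fun_prop

lemma charFun_map_weightedPair {h : ℝ → ℝ} (hh : Measurable h) {n : ℕ} (p q : Fin n → ℝ)
    (t : ℂ) : charFun ((stateLaw n).map (weightedPair h p q)) t =
      ∏ i, ∫ x, Complex.exp ((t.re * p i * x + t.im * q i * h x : ℝ) * Complex.I)
        ∂stdNormal := by
  rw [charFun_apply, integral_map (measurable_weightedPair hh p q).aemeasurable (by fun_prop)]
  -- The trailing factor 1 is the function of the coin, so that the product integral separates.
  have e : ∀ ω : State n, Complex.exp ((inner ℝ (weightedPair h p q ω) t : ℝ) * Complex.I) =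
      (∏ i, Complex.exp ((t.re * p i * ω.1 i + t.im * q i * h (ω.1 i) : ℝ) * Complex.I)) *
        1 := by
    intro ω
    rw [mul_one, ← Complex.exp_sum, ← Finset.sum_mul, ← Complex.ofReal_sum, Complex.inner,
      Complex.mul_re, Complex.conj_re, Complex.conj_im, weightedPair_re, weightedPair_im,
      Finset.sum_add_distrib]
    congr 3
    simp only [mul_neg, sub_neg_eq_add, Finset.mul_sum]
    congr 1 <;> exact Finset.sum_congr rfl fun i _ => by ring
  simp_rw [e]
  rw [stateLaw, integral_prod_mul (fun ω : Fin n → ℝ => ∏ i, Complex.exp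
      ((t.re * p i * ω i + t.im * q i * h (ω i) : ℝ) * Complex.I)) (fun _ : ℝ => (1 : ℂ)),
    integral_fintype_prod_eq_prod (fun i (x : ℝ) => Complex.exp
      ((t.re * p i * x + t.im * q i * h x : ℝ) * Complex.I))]
  simp

lemma measurable_sign : Measurable Real.sign := by
  unfold Real.sign
  exact Measurable.ite measurableSet_Iio measurable_const
    (Measurable.ite measurableSet_Ioi measurable_const measurable_const)

lemma abs_sign_le_one (x : ℝ) : |Real.sign x| ≤ 1 := by
  rcases Real.sign_apply_eq x with h | h | h <;> simp [h]

lemma mul_sign_eq_abs (x : ℝ) : x * Real.sign x = |x| := by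
  rcases lt_trichotomy x 0 with h | rfl | h
  · simp [Real.sign_of_neg h, abs_of_neg h]
  · simp
  · simp [Real.sign_of_pos h, abs_of_pos h]

lemma integrable_sign : Integrable Real.sign stdNormal :=
  Integrable.of_bound (C := 1) measurable_sign.aestronglyMeasurable
    (ae_of_all _ abs_sign_le_one)

lemma integral_sign_stdNormal : ∫ x, Real.sign x ∂stdNormal = 0 := by
  have h : stdNormal.map (fun x => -x) = stdNormal := by
    simpa using gaussianReal_map_neg (μ := 0) (v := 1)
  have h1 : ∫ x, Real.sign x ∂stdNormal = -∫ x, Real.sign x ∂stdNormal := by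
    conv_lhs => rw [← h]
    rw [integral_map (by fun_prop) measurable_sign.aestronglyMeasurable, ← integral_neg]
    simp_rw [Real.sign_neg]
  linarith

/-- The cross term `x * sign x = |x|` is where `absMoment` enters; `sign² = 1` fails only at 0. -/
lemma integral_sq_add_sign (α β : ℝ) :
    ∫ x, (α * x + β * Real.sign x) ^ 2 ∂stdNormal =
      α ^ 2 + 2 * absMoment * (α * β) + β ^ 2 := by
  have h : (fun x => (α * x + β * Real.sign x) ^ 2) =ᵐ[stdNormal]
      fun x => α ^ 2 * x ^ 2 + 2 * (α * β) * |x| + β ^ 2 := by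
    have h0 : ∀ᵐ x ∂stdNormal, x ≠ 0 := by
      rw [ae_iff]; simp
    filter_upwards [h0] with x hx
    have : Real.sign x ^ 2 = 1 := by
      rcases Real.sign_apply_eq_of_ne_zero x hx with h | h <;> simp [h]
    rw [← mul_sign_eq_abs]
    linear_combination β ^ 2 * this
  rw [integral_congr_ae h, integral_add _ (integrable_const _), integral_add,
    integral_const_mul, integral_const_mul, integral_sq_stdNormal]
  · simp [absMoment]; ring
  · exact integrable_sq_stdNormal.const_mul _
  · exact integrable_id_stdNormal.abs.const_mul _
  · exact (integrable_sq_stdNormal.const_mul _).add (integrable_id_stdNormal.abs.const_mul _)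

lemma integral_add_sign (α β : ℝ) : ∫ x, (α * x + β * Real.sign x) ∂stdNormal = 0 := by
  rw [integral_add (integrable_id_stdNormal.const_mul α) (integrable_sign.const_mul β),
    integral_const_mul, integral_const_mul, integral_sign_stdNormal, integral_id_gaussianReal]
  simp

/-- Each factor is compared with the Gaussian factor of equal variance, and these multiply to the
stated exponential. -/
lemma norm_charFun_weightedPair_sign_sub_le {n : ℕ} (p q : Fin n → ℝ) (t : ℂ) {M : ℝ}
    (hM1 : M ≤ 1) (hp : ∀ i, |t.re * p i| ≤ M) (hq : ∀ i, |t.im * q i| ≤ M) :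
    ‖charFun ((stateLaw n).map (weightedPair Real.sign p q)) t -
      Complex.exp (-(t.re ^ 2 * ∑ i, p i ^ 2 +
        2 * absMoment * (t.re * t.im) * ∑ i, p i * q i + t.im ^ 2 * ∑ i, q i ^ 2 : ℝ) / 2)‖ ≤
      n * ((4 * thirdMoment + thirdMoment ^ 2) * M ^ 3) := by
  rw [charFun_map_weightedPair measurable_sign]
  have e : Complex.exp (-(t.re ^ 2 * ∑ i, p i ^ 2 +
        2 * absMoment * (t.re * t.im) * ∑ i, p i * q i + t.im ^ 2 * ∑ i, q i ^ 2 : ℝ) / 2) =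
      ∏ i, Complex.exp
        (-(∫ x, (t.re * p i * x + t.im * q i * Real.sign x) ^ 2 ∂stdNormal : ℝ) / 2) := by
    rw [← Complex.exp_sum, ← Finset.sum_div, Finset.sum_neg_distrib, ← Complex.ofReal_sum]
    congr 4
    simp_rw [integral_sq_add_sign, Finset.sum_add_distrib, Finset.mul_sum]
    refine congrArg₂ _ (congrArg₂ _ ?_ ?_) ?_ <;>
      exact Finset.sum_congr rfl fun i _ => by ring
  rw [e]
  refine (norm_prod_sub_prod_le_sum _ _ _ (fun i => ?_) fun i => ?_).trans ?_
  · refine (norm_integral_le_of_norm_le_const (C := 1)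
      (ae_of_all _ fun x => (Complex.norm_exp_ofReal_mul_I _).le)).trans ?_
    simp
  · rw [Complex.norm_exp, Real.exp_le_one_iff]
    have : 0 ≤ ∫ x, (t.re * p i * x + t.im * q i * Real.sign x) ^ 2 ∂stdNormal :=
      integral_nonneg fun x => sq_nonneg _
    rw [← Complex.ofReal_neg, ← Complex.ofReal_ofNat, ← Complex.ofReal_div, Complex.ofReal_re]
    linarith
  · refine (Finset.sum_le_card_nsmul _ _ _ fun i _ =>
      norm_integral_exp_sub_le (M := M) ?_ hM1 (fun x => ?_) (integral_add_sign _ _)).trans ?_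
    · exact (measurable_id.const_mul _).add (measurable_sign.const_mul _)
    · refine (abs_add_le _ _).trans ?_
      rw [abs_mul, abs_mul (t.im * q i)]
      nlinarith [mul_le_mul_of_nonneg_right (hp i) (abs_nonneg x),
        mul_le_mul (hq i) (abs_sign_le_one x) (abs_nonneg _) ((abs_nonneg _).trans (hq i))]
    · simp

/-- The weighted sums `∑ p i * N i` and `∑ q i * sign (N i)` with uniformly small normalized
coefficients are asymptotically bivariate normal. -/
theorem tendsto_charFun_weightedPair_sign (p q : ∀ n : ℕ, Fin n → ℝ) {L κ : ℝ}
    (hp : ∀ᶠ n in atTop, ∀ i, |p n i| ≤ L / √n) (hq : ∀ᶠ n in atTop, ∀ i, |q n i| ≤ L / √n)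
    (hpp : Tendsto (fun n => ∑ i, p n i ^ 2) atTop (𝓝 1))
    (hqq : Tendsto (fun n => ∑ i, q n i ^ 2) atTop (𝓝 1))
    (hpq : Tendsto (fun n => ∑ i, p n i * q n i) atTop (𝓝 κ))
    (hκ : absMoment * κ ∈ Icc (0 : ℝ) 1) (t : ℂ) :
    Tendsto (fun n => charFun ((stateLaw n).map (weightedPair Real.sign (p n) (q n))) t) atTop
      (𝓝 (charFun (corrLaw (absMoment * κ)) t)) := by
  rw [charFun_corrLaw hκ]
  have hmain : Tendsto (fun n => Complex.exp (-(t.re ^ 2 * ∑ i, p n i ^ 2 +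
        2 * absMoment * (t.re * t.im) * ∑ i, p n i * q n i +
        t.im ^ 2 * ∑ i, q n i ^ 2 : ℝ) / 2)) atTop
      (𝓝 (Complex.exp (-(t.re ^ 2 + 2 * (absMoment * κ) * t.re * t.im + t.im ^ 2 : ℝ) / 2))) := by
    refine (Complex.continuous_exp.tendsto _).comp
      (Tendsto.div_const (Tendsto.neg ((Complex.continuous_ofReal.tendsto _).comp ?_)) _)
    have := ((hpp.const_mul (t.re ^ 2)).add (hpq.const_mul (2 * absMoment * (t.re * t.im)))).add
      (hqq.const_mul (t.im ^ 2))
    convert this using 2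
    ring
  set R := (|t.re| + |t.im|) * L with hR
  have hsqrt : Tendsto (fun n : ℕ => √(n : ℝ)) atTop atTop :=
    Real.tendsto_sqrt_atTop.comp tendsto_natCast_atTop_atTop
  have hM : Tendsto (fun n : ℕ => R / √(n : ℝ)) atTop (𝓝 0) := hsqrt.const_div_atTop R
  -- There are `n` factors, each with error of order `n^(-3/2)`.
  have herr : Tendsto (fun n : ℕ =>
      (n : ℝ) * ((4 * thirdMoment + thirdMoment ^ 2) * (R / √(n : ℝ)) ^ 3)) atTop (𝓝 0) := by
    refine (hsqrt.const_div_atTop ((4 * thirdMoment + thirdMoment ^ 2) * R ^ 3)).congr' ?_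
    filter_upwards [eventually_gt_atTop 0] with n hn
    have hn' : 0 < √(n : ℝ) := Real.sqrt_pos.2 (by exact_mod_cast hn)
    have : (n : ℝ) = √(n : ℝ) ^ 2 := (Real.sq_sqrt (by positivity)).symm
    nth_rw 2 [this]
    field_simp
  have hdiff := squeeze_zero_norm' (f := fun n =>
    charFun ((stateLaw n).map (weightedPair Real.sign (p n) (q n))) t -
      Complex.exp (-(t.re ^ 2 * ∑ i, p n i ^ 2 +
        2 * absMoment * (t.re * t.im) * ∑ i, p n i * q n i +
        t.im ^ 2 * ∑ i, q n i ^ 2 : ℝ) / 2)) ?_ herr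
  · simpa using hdiff.add hmain
  · filter_upwards [hp, hq, hM.eventually (eventually_le_nhds zero_lt_one)] with n hpn hqn hMn
    refine norm_charFun_weightedPair_sign_sub_le _ _ t hMn (fun i => ?_) fun i => ?_
    · have h0 := (abs_nonneg _).trans (hpn i)
      rw [abs_mul, hR, mul_div_assoc]
      nlinarith [mul_le_mul_of_nonneg_left (hpn i) (abs_nonneg t.re),
        mul_nonneg (abs_nonneg t.im) h0]
    · have h0 := (abs_nonneg _).trans (hqn i)
      rw [abs_mul, hR, mul_div_assoc]
      nlinarith [mul_le_mul_of_nonneg_left (hqn i) (abs_nonneg t.im),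
        mul_nonneg (abs_nonneg t.re) h0]

/-! ### Averages over the group sizes -/

lemma sizeDist_apply (s : ℕ → ℝ) (n : ℕ) [NeZero n] :
    (sizeDist s n : Measure ℝ) = (n : ENNReal)⁻¹ • ∑ i : Fin n, Measure.dirac (s i) := rfl

lemma ae_sizeDist_iff (s : ℕ → ℝ) (n : ℕ) [NeZero n] (P : ℝ → Prop) :
    (∀ᵐ x ∂(sizeDist s n : Measure ℝ), P x) ↔ ∀ i : Fin n, P (s i) := by
  rw [sizeDist_apply, ae_iff, Measure.smul_apply, Measure.finsetSum_apply]
  simp [Finset.sum_eq_zero_iff]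

lemma integral_sizeDist (s : ℕ → ℝ) (n : ℕ) [NeZero n] (f : ℝ → ℝ) :
    ∫ x, f x ∂(sizeDist s n : Measure ℝ) = (n : ℝ)⁻¹ * ∑ i : Fin n, f (s i) := by
  rw [sizeDist_apply, integral_smul_measure, integral_finsetSum_measure]
  · simp
  · intro i _
    exact integrable_dirac (by simp)

lemma sizeDist_eq_one {s : ℕ → ℝ} {A : Set ℝ} (h : ∀ i, s i ∈ A) (n : ℕ) [NeZero n] :
    (sizeDist s n : Measure ℝ) A = 1 := by
  have h' : A =ᵐ[(sizeDist s n : Measure ℝ)] (univ : Set ℝ) :=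
    eventuallyEq_univ.2 ((ae_sizeDist_iff s n (· ∈ A)).2 fun i => h i)
  rw [measure_congr h', measure_univ]

section SizeAverages

variable {s : ℕ → ℝ} {Ψ : ProbabilityMeasure ℝ}

lemma ae_mem_of_tendsto_sizeDist
    (hΨ : Tendsto (fun n : ℕ => sizeDist s (n + 1)) atTop (𝓝 Ψ)) {F : Set ℝ} (hF : IsClosed F)
    (hs : ∀ i, s i ∈ F) : ∀ᵐ x ∂(Ψ : Measure ℝ), x ∈ F := by
  have h := ProbabilityMeasure.limsup_measure_closed_le_of_tendsto hΨ hF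
  simp only [sizeDist_eq_one hs, limsup_const] at h
  exact (mem_ae_iff_prob_eq_one hF.measurableSet).2 (le_antisymm prob_le_one h)

/-- A continuous mapping theorem using continuity along `range s` only. The empirical measures live
on `range s`, so the preimage of a closed `F` may be cut down to `range s` and then closed; almost
every point of that closure is again mapped into `F`. -/
lemma tendsto_map_sizeDist (hΨ : Tendsto (fun n : ℕ => sizeDist s (n + 1)) atTop (𝓝 Ψ))
    {h : ℝ → ℝ} (hm : Measurable h)
    (hc : ∀ᵐ x ∂(Ψ : Measure ℝ), ContinuousWithinAt h (range s) x) :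
    Tendsto (fun n : ℕ => (sizeDist s (n + 1)).map hm.aemeasurable) atTop
      (𝓝 (Ψ.map hm.aemeasurable)) := by
  refine tendsto_of_forall_isClosed_limsup_le' fun F hF => ?_
  simp only [ProbabilityMeasure.toMeasure_map, Measure.map_apply hm hF.measurableSet]
  calc limsup (fun n : ℕ => (sizeDist s (n + 1) : Measure ℝ) (h ⁻¹' F)) atTop
      ≤ limsup (fun n : ℕ => (sizeDist s (n + 1) : Measure ℝ)
          (closure (h ⁻¹' F ∩ range s))) atTop := by
        refine limsup_le_limsup (Eventually.of_forall fun n => ?_)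
        refine measure_mono_ae ?_
        have : ∀ᵐ x ∂(sizeDist s (n + 1) : Measure ℝ), x ∈ range s :=
          (ae_sizeDist_iff s _ _).2 fun i => mem_range_self _
        filter_upwards [this] with x hx hxF
        exact subset_closure ⟨hxF, hx⟩
    _ ≤ (Ψ : Measure ℝ) (closure (h ⁻¹' F ∩ range s)) :=
        ProbabilityMeasure.limsup_measure_closed_le_of_tendsto hΨ isClosed_closure
    _ ≤ (Ψ : Measure ℝ) (h ⁻¹' F) := by
        refine measure_mono_ae ?_
        filter_upwards [hc] with x hx hxF
        have h1 : h x ∈ closure (h '' (h ⁻¹' F ∩ range s)) :=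
          (hx.mono inter_subset_right).mem_closure_image hxF
        exact hF.closure_subset_iff.2 (by rintro _ ⟨y, hy, rfl⟩; exact hy.1) h1

lemma tendsto_average_of_measurable
    (hΨ : Tendsto (fun n : ℕ => sizeDist s (n + 1)) atTop (𝓝 Ψ))
    {h : ℝ → ℝ} (hm : Measurable h)
    (hc : ∀ᵐ x ∂(Ψ : Measure ℝ), ContinuousWithinAt h (range s) x) {B : ℝ}
    (hB : ∀ x, |h x| ≤ B) :
    Tendsto (fun n : ℕ => (n : ℝ)⁻¹ * ∑ i : Fin n, h (s i)) atTop (𝓝 (∫ x, h x ∂Ψ)) := by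
  have hmap := tendsto_map_sizeDist hΨ hm hc
  rw [ProbabilityMeasure.tendsto_iff_forall_integral_tendsto] at hmap
  -- Clamping to `[-B, B]` is a bounded continuous test function that leaves the values of `h`
  -- unchanged.
  let f : BoundedContinuousFunction ℝ ℝ := BoundedContinuousFunction.ofNormedAddCommGroup
    (fun y => max (-B) (min y B)) (by fun_prop) |B| fun y => by
      rw [Real.norm_eq_abs, abs_le]
      constructor
      · exact le_max_of_le_left (neg_le_neg (le_abs_self B))
      · exact max_le (neg_le_abs B) ((min_le_right _ _).trans (le_abs_self B))
  have hf : ∀ x, f (h x) = h x := fun x => by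
    have := abs_le.1 (hB x)
    change max (-B) (min (h x) B) = h x
    rw [min_eq_left this.2, max_eq_right this.1]
  have h1 := hmap f
  simp only [ProbabilityMeasure.toMeasure_map] at h1
  rw [integral_map hm.aemeasurable f.continuous.measurable.aestronglyMeasurable] at h1
  simp only [integral_map hm.aemeasurable f.continuous.measurable.aestronglyMeasurable, hf,
    integral_sizeDist] at h1
  -- The empirical measures are indexed by `n + 1`, the averages by `n`.
  exact (tendsto_add_atTop_iff_nat 1).1 h1

/-- Averages over the group sizes of a bounded function on `[0, sbar]` that is almost everywhere
continuous along the sizes converge to its integral. -/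
lemma tendsto_average {sbar : ℝ} (hs : ∀ i, s i ∈ Ioc 0 sbar)
    (hΨ : Tendsto (fun n : ℕ => sizeDist s (n + 1)) atTop (𝓝 Ψ)) {h : ℝ → ℝ}
    (hm : Measurable ((Icc 0 sbar).indicator h))
    (hc : ∀ᵐ x ∂(Ψ : Measure ℝ), ContinuousWithinAt h (range s) x) {B : ℝ}
    (hB : ∀ x ∈ Icc 0 sbar, |h x| ≤ B) :
    Tendsto (fun n : ℕ => (n : ℝ)⁻¹ * ∑ i : Fin n, h (s i)) atTop (𝓝 (∫ x, h x ∂Ψ)) := by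
  have hmem : ∀ᵐ x ∂(Ψ : Measure ℝ), x ∈ Icc 0 sbar :=
    ae_mem_of_tendsto_sizeDist hΨ isClosed_Icc fun i => Ioc_subset_Icc_self (hs i)
  have h0 : 0 ≤ B := (abs_nonneg _).trans (hB (s 0) (Ioc_subset_Icc_self (hs 0)))
  -- Cutting off outside `[0, sbar]` makes `h` measurable and bounded everywhere without changing it
  -- at the sizes or almost everywhere.
  have key := tendsto_average_of_measurable hΨ hm (B := B) ?_ ?_
  · have e : ∫ x, (Icc 0 sbar).indicator h x ∂(Ψ : Measure ℝ) = ∫ x, h x ∂(Ψ : Measure ℝ) :=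
      integral_congr_ae (by filter_upwards [hmem] with x hx using indicator_of_mem hx h)
    rw [e] at key
    refine key.congr fun n => ?_
    congr 1
    exact Finset.sum_congr rfl fun i _ => indicator_of_mem (Ioc_subset_Icc_self (hs i)) h
  · filter_upwards [hmem, hc] with x hx hcx
    refine hcx.congr ?_ (indicator_of_mem hx h)
    rintro _ ⟨i, rfl⟩
    exact indicator_of_mem (Ioc_subset_Icc_self (hs i)) h
  · intro x
    by_cases hx : x ∈ Icc 0 sbar
    · rw [indicator_of_mem hx]; exact hB x hx
    · rw [indicator_of_notMem hx, abs_zero]; exact h0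

end SizeAverages

/-! ### Welfare as a function of a pair of weighted sums -/

lemma coin_ae : ∀ᵐ x ∂coin, x = 1 ∨ x = -1 := by
  have hm : MeasurableSet {x : ℝ | ¬(x = 1 ∨ x = -1)} :=
    ((measurableSet_singleton (1 : ℝ)).union (measurableSet_singleton (-1 : ℝ))).compl
  rw [ae_iff, coin, Measure.smul_apply, Measure.add_apply, Measure.dirac_apply' _ hm,
    Measure.dirac_apply' _ hm]
  simp

lemma stateLaw_ae_coin (n : ℕ) : ∀ᵐ ω ∂stateLaw n, ω.2 = 1 ∨ ω.2 = -1 :=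
  Measure.quasiMeasurePreserving_snd.ae coin_ae

lemma totalVoteMargin_eq {s : ℕ → ℝ} (n : ℕ) (ω : State n) :
    totalVoteMargin s n ω = ∑ i : Fin n, √(s i) * ω.1 i := by
  refine Finset.sum_congr rfl fun i _ => ?_
  rw [voteMargin, mul_div_left_comm, Real.div_sqrt, mul_comm]

lemma variance_totalVoteMargin {s : ℕ → ℝ} (hs : ∀ i, 0 < s i) (n : ℕ) :
    Var[totalVoteMargin s n; stateLaw n] = ∑ i : Fin n, s i := by
  have h1 : totalVoteMargin s n = fun ω : State n =>
      (fun η : Fin n → ℝ => ∑ i : Fin n, √(s i) * η i) ω.1 :=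
    funext fun ω => totalVoteMargin_eq n ω
  have h2 := variance_sum_pi (μ := fun _ : Fin n => stdNormal)
    (X := fun (i : Fin n) (x : ℝ) => √(s i) * x)
    fun i => (memLp_id_stdNormal 2 (by simp)).const_mul (√(s i))
  have h3 : (∑ i : Fin n, fun η : Fin n → ℝ => √(s i) * η i) =
      fun η : Fin n → ℝ => ∑ i : Fin n, √(s i) * η i := by ext; simp
  have h4 : MeasurePreserving Prod.fst (stateLaw n) (Measure.pi fun _ : Fin n => stdNormal) :=
    measurePreserving_fst
  have h5 : Measurable fun η : Fin n → ℝ => ∑ i : Fin n, √(s i) * η i := by fun_prop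
  rw [h1, h4.variance_fun_comp h5.aemeasurable, ← h3, h2]
  refine Finset.sum_congr rfl fun i _ => ?_
  rw [variance_const_mul, variance_fun_id_gaussianReal, Real.sq_sqrt (hs i).le]
  simp

lemma measurable_totalVoteMargin (s : ℕ → ℝ) (n : ℕ) : Measurable (totalVoteMargin s n) := by
  unfold totalVoteMargin voteMargin; fun_prop

lemma measurable_totalWeightMargin {r : ℝ → ℝ} (hr : Measurable r) (s : ℕ → ℝ) (a : ℝ → ℝ)
    (n : ℕ) : Measurable (totalWeightMargin r s a n) := by
  unfold totalWeightMargin voteMargin; fun_prop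

lemma measurable_welfare {r : ℝ → ℝ} (hr : Measurable r) (s : ℕ → ℝ) (a : ℝ → ℝ) (n : ℕ) :
    Measurable (welfare r s a n) := by
  have hT := measurable_totalWeightMargin hr s a n
  have hD : Measurable (decision r s a n) :=
    Measurable.ite (hT (measurableSet_singleton 0)) measurable_snd (measurable_sign.comp hT)
  exact (hD.mul (measurable_totalVoteMargin s n)).div_const _

/-- Normalized total vote margin and total weight margin are the real and imaginary parts of
`weightedPair h p q`, up to the positive factor `τ`. -/
structure IsNormalizedPair (r h : ℝ → ℝ) (s : ℕ → ℝ) (a : ℝ → ℝ) {n : ℕ} (p q : Fin n → ℝ)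
    (τ : ℝ) : Prop where
  pos : 0 < τ
  margin_eq : ∀ ω : State n,
    totalVoteMargin s n ω / √(Var[totalVoteMargin s n; stateLaw n]) = (weightedPair h p q ω).re
  weightMargin_eq : ∀ ω : State n,
    totalWeightMargin r s a n ω = τ * (weightedPair h p q ω).im

namespace IsNormalizedPair

variable {r h : ℝ → ℝ} {s : ℕ → ℝ} {a : ℝ → ℝ} {n : ℕ} {p q : Fin n → ℝ} {τ : ℝ}

lemma welfare_of_im_ne (H : IsNormalizedPair r h s a p q τ) {ω : State n}
    (hω : (weightedPair h p q ω).im ≠ 0) :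
    welfare r s a n ω = signedRe (weightedPair h p q ω) := by
  rw [welfare, mul_div_assoc, H.margin_eq, decision, H.weightMargin_eq,
    if_neg (mul_ne_zero H.pos.ne' hω), signedRe]
  rcases lt_or_gt_of_ne hω with h0 | h0
  · rw [Real.sign_of_neg (mul_neg_of_pos_of_neg H.pos h0), if_neg h0.not_ge]; ring
  · rw [Real.sign_of_pos (mul_pos H.pos h0), if_pos h0.le]; ring

lemma welfare_of_im_eq (H : IsNormalizedPair r h s a p q τ) {ω : State n}
    (hω : (weightedPair h p q ω).im = 0) :
    welfare r s a n ω = ω.2 * (weightedPair h p q ω).re := by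
  rw [welfare, mul_div_assoc, H.margin_eq, decision, H.weightMargin_eq, hω, mul_zero,
    if_pos rfl]

end IsNormalizedPair

/-- Ties form a null event because `corrLaw c` does not charge the real axis. -/
lemma welfareLaw_eq_signedLaw {r h : ℝ → ℝ} {s : ℕ → ℝ} {a : ℝ → ℝ} {n : ℕ} {p q : Fin n → ℝ}
    {τ c : ℝ} (hh : Measurable h) (H : IsNormalizedPair r h s a p q τ) (hc : c ∈ Icc (0 : ℝ) 1)
    (hlaw : (stateLaw n).map (weightedPair h p q) = corrLaw c) :
    welfareLaw r s a n = signedLaw c := by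
  have hm := measurable_weightedPair hh p q
  have hae : welfare r s a n =ᵐ[stateLaw n] signedRe ∘ weightedPair h p q := by
    have := corrLaw_ae_im_ne hc
    rw [← hlaw] at this
    filter_upwards [ae_of_ae_map hm.aemeasurable this] with ω hω
    exact H.welfare_of_im_ne hω
  rw [welfareLaw, Measure.map_congr hae, ← Measure.map_map measurable_signedRe hm, hlaw,
    signedLaw]

/-- The signed real part may take both values `±re` on the real axis: a closed enlargement of the
preimage of a closed set under `signedRe`. -/
def signedPreimage (F : Set ℝ) : Set ℂ :=
  {z | 0 ≤ z.im ∧ z.re ∈ F} ∪ {z | z.im ≤ 0 ∧ -z.re ∈ F}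

lemma isClosed_signedPreimage {F : Set ℝ} (hF : IsClosed F) : IsClosed (signedPreimage F) :=
  ((isClosed_le continuous_const Complex.continuous_im).inter
    (hF.preimage Complex.continuous_re)).union
    ((isClosed_le Complex.continuous_im continuous_const).inter
      (hF.preimage Complex.continuous_re.neg))

/-- `signedLaw c` as a bundled probability measure. -/
def signedProb (c : ℝ) : ProbabilityMeasure ℝ := ⟨signedLaw c, inferInstance⟩

@[simp]
lemma coe_signedProb (c : ℝ) : (signedProb c : Measure ℝ) = signedLaw c := rfl

/-- If the pair of normalized margins converges to a bivariate normal law, welfare converges to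
the law of its signed real part. -/
theorem isLimitWelfareLaw_of_tendsto_charFun {r h : ℝ → ℝ} {s : ℕ → ℝ} {a : ℝ → ℝ}
    (hr : Measurable r) (hh : Measurable h) {p q : ∀ n : ℕ, Fin n → ℝ} {τ : ℕ → ℝ} {c : ℝ}
    (H : ∀ᶠ n in atTop, IsNormalizedPair r h s a (p n) (q n) (τ n)) (hc : c ∈ Icc (0 : ℝ) 1)
    (hlim : ∀ t : ℂ, Tendsto
      (fun n => charFun ((stateLaw n).map (weightedPair h (p n) (q n))) t) atTop
      (𝓝 (charFun (corrLaw c) t))) :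
    IsLimitWelfareLaw r s a (signedProb c) where
  forall_aemeasurable n := (measurable_welfare hr s a n).aemeasurable
  aemeasurable_limit := aemeasurable_id
  tendsto := by
    have hm := fun n => measurable_weightedPair hh (p n) (q n)
    let μ : ℕ → ProbabilityMeasure ℂ := fun n =>
      ⟨(stateLaw n).map (weightedPair h (p n) (q n)),
        Measure.isProbabilityMeasure_map (hm n).aemeasurable⟩
    have hμ : Tendsto μ atTop (𝓝 ⟨corrLaw c, inferInstance⟩) :=
      ProbabilityMeasure.tendsto_of_tendsto_charFun hlim
    refine tendsto_of_forall_isClosed_limsup_le' fun F hF => ?_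
    have hcl := isClosed_signedPreimage hF
    simp only [ProbabilityMeasure.coe_mk, Measure.map_id, coe_signedProb]
    calc limsup (fun n => (stateLaw n).map (welfare r s a n) F) atTop
        ≤ limsup (fun n => (μ n : Measure ℂ) (signedPreimage F)) atTop := by
          refine limsup_le_limsup ?_
          filter_upwards [H] with n Hn
          simp only [μ, ProbabilityMeasure.coe_mk]
          rw [Measure.map_apply (measurable_welfare hr s a n) hF.measurableSet,
            Measure.map_apply (hm n) hcl.measurableSet]
          refine measure_mono_ae ?_
          filter_upwards [stateLaw_ae_coin n] with ω hω hωF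
          have hωF : welfare r s a n ω ∈ F := hωF
          change weightedPair h (p n) (q n) ω ∈ signedPreimage F
          -- On a tie the coin makes welfare `±re`; the enlarged set contains the point in either
          -- case.
          rcases eq_or_ne (weightedPair h (p n) (q n) ω).im 0 with h0 | h0
          · rw [Hn.welfare_of_im_eq h0] at hωF
            rcases hω with h1 | h1
            · exact Or.inl ⟨h0.ge, by simpa [h1] using hωF⟩
            · exact Or.inr ⟨h0.le, by simpa [h1] using hωF⟩
          · rw [Hn.welfare_of_im_ne h0, signedRe] at hωF
            split_ifs at hωF with h1
            · exact Or.inl ⟨h1, hωF⟩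
            · exact Or.inr ⟨(not_le.1 h1).le, hωF⟩
      _ ≤ corrLaw c (signedPreimage F) :=
          ProbabilityMeasure.limsup_measure_closed_le_of_tendsto hμ hcl
      -- The enlargement adds only points of the real axis, which are null in the limit.
      _ ≤ signedLaw c F := by
          rw [signedLaw, Measure.map_apply measurable_signedRe hF.measurableSet]
          refine measure_mono_ae ?_
          filter_upwards [corrLaw_ae_im_ne hc] with z hz hzF
          change signedRe z ∈ F
          rcases hzF with ⟨h1, h2⟩ | ⟨h1, h2⟩
          · rwa [signedRe, if_pos h1]
          · rwa [signedRe, if_neg (lt_of_le_of_ne h1 hz).not_ge]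

lemma margin_div_sd_eq {s : ℕ → ℝ} (hs : ∀ i, 0 < s i) (h : ℝ → ℝ) {n : ℕ} (q : Fin n → ℝ)
    (ω : State n) :
    totalVoteMargin s n ω / √(Var[totalVoteMargin s n; stateLaw n]) =
      (weightedPair h (fun i : Fin n => √(s i) / √(∑ i : Fin n, s i)) q ω).re := by
  rw [variance_totalVoteMargin hs, totalVoteMargin_eq, weightedPair_re, Finset.sum_div]
  exact Finset.sum_congr rfl fun i _ => by ring

/-! ### Proportional representation -/

lemma map_weightedPair_id {n : ℕ} {p q : Fin n → ℝ} {c : ℝ} (hp : ∑ i, p i ^ 2 = 1)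
    (hq : ∑ i, q i ^ 2 = 1) (hpq : ∑ i, p i * q i = c) (hc : c ∈ Icc (0 : ℝ) 1) :
    (stateLaw n).map (weightedPair (fun x => x) p q) = corrLaw c := by
  refine eq_corrLaw_of_charFun hc fun t => ?_
  rw [charFun_map_weightedPair measurable_id']
  have e : ∀ i, ∫ x, Complex.exp ((t.re * p i * x + t.im * q i * x : ℝ) * Complex.I)
      ∂stdNormal = Complex.exp (-((t.re * p i + t.im * q i : ℝ) ^ 2 : ℂ) / 2) := by
    intro i
    rw [← integral_exp_mul_I_stdNormal]
    congr 1
    ext x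
    push_cast
    ring_nf
  simp_rw [e]
  rw [← Complex.exp_sum, ← Finset.sum_div, Finset.sum_neg_distrib]
  congr 3
  norm_cast
  have : ∀ i, (t.re * p i + t.im * q i) ^ 2 =
      t.re ^ 2 * p i ^ 2 + 2 * (t.re * t.im) * (p i * q i) + t.im ^ 2 * q i ^ 2 := fun i => by
    ring
  simp_rw [this, Finset.sum_add_distrib, ← Finset.mul_sum, hp, hq, hpq]
  ring

lemma sum_mul_le_one {ι : Type*} {S : Finset ι} {p q : ι → ℝ} (hp : ∑ i ∈ S, p i ^ 2 = 1)
    (hq : ∑ i ∈ S, q i ^ 2 = 1) : ∑ i ∈ S, p i * q i ≤ 1 := by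
  have h : ∑ i ∈ S, p i * q i ≤ ∑ i ∈ S, (p i ^ 2 + q i ^ 2) / 2 :=
    Finset.sum_le_sum fun i _ => by nlinarith [sq_nonneg (p i - q i)]
  rw [← Finset.sum_div, Finset.sum_add_distrib, hp, hq] at h
  linarith

lemma sum_div_sqrt_sq {ι : Type*} {S : Finset ι} (f : ι → ℝ) (h : 0 < ∑ i ∈ S, f i ^ 2) :
    ∑ i ∈ S, (f i / √(∑ j ∈ S, f j ^ 2)) ^ 2 = 1 := by
  simp_rw [div_pow, Real.sq_sqrt h.le]
  rw [← Finset.sum_div, div_self h.ne']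

lemma sum_sq_sqrt_size {s : ℕ → ℝ} {n : ℕ} (hs : ∀ i, 0 < s i) :
    ∑ i : Fin n, √(s i) ^ 2 = ∑ i : Fin n, s i :=
  Finset.sum_congr rfl fun i _ => Real.sq_sqrt (hs i).le

section PropRep

variable {sbar abar : ℝ} {s : ℕ → ℝ} {a : ℝ → ℝ} {n : ℕ} [NeZero n]

lemma sum_size_pos (hs : ∀ i, 0 < s i) : 0 < ∑ i : Fin n, s i :=
  Finset.sum_pos (fun i _ => hs i) Finset.univ_nonempty

/-- Exhibits the index as the inner product of the unit vectors along `√(s i)` and `a (s i) / √(s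
i)`, the coefficients of `N i` in the two margins. -/
lemma propCosine_eq_sum (hs : ∀ i, 0 < s i) :
    propCosine s n a = ∑ i : Fin n, √(s i) / √(∑ i : Fin n, s i) *
      (a (s i) / √(s i) / √(∑ i : Fin n, (a (s i) / √(s i)) ^ 2)) := by
  have e : ∑ i : Fin n, a (s i) ^ 2 / s i = ∑ i : Fin n, (a (s i) / √(s i)) ^ 2 :=
    Finset.sum_congr rfl fun i _ => by rw [div_pow, Real.sq_sqrt (hs i).le]
  rw [propCosine, e, Real.sqrt_mul (sum_size_pos hs).le, Finset.sum_div]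
  refine Finset.sum_congr rfl fun i _ => ?_
  have := (Real.sqrt_pos.2 (hs i)).ne'
  field_simp

lemma sum_sq_weight_pos (hs : ∀ i, s i ∈ Ioc 0 sbar)
    (ha : IsWeightAllocation sbar abar (sizeDist s n) a) :
    0 < ∑ i : Fin n, (a (s i) / √(s i)) ^ 2 := by
  have h := ha.not_ae_zero
  rw [ae_sizeDist_iff] at h
  push Not at h
  obtain ⟨i, hi⟩ := h
  refine Finset.sum_pos' (fun i _ => sq_nonneg _) ⟨i, Finset.mem_univ _, ?_⟩
  have := div_ne_zero hi (Real.sqrt_pos.2 (hs i).1).ne'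
  positivity

lemma propCosine_mem (hs : ∀ i, s i ∈ Ioc 0 sbar)
    (ha : IsWeightAllocation sbar abar (sizeDist s n) a) :
    propCosine s n a ∈ Icc (0 : ℝ) 1 := by
  have hpos := fun i => (hs i).1
  constructor
  · exact div_nonneg (Finset.sum_nonneg fun i _ => (ha.mapsTo (Ioc_subset_Icc_self (hs i))).1)
      (Real.sqrt_nonneg _)
  · rw [propCosine_eq_sum hpos]
    refine sum_mul_le_one ?_ (sum_div_sqrt_sq _ (sum_sq_weight_pos hs ha))
    have := sum_div_sqrt_sq (S := Finset.univ) (fun i : Fin n => √(s i))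
      (by rw [sum_sq_sqrt_size hpos]; exact sum_size_pos hpos)
    rwa [sum_sq_sqrt_size hpos] at this

theorem welfareLaw_proportionalRep (hs : ∀ i, s i ∈ Ioc 0 sbar)
    (ha : IsWeightAllocation sbar abar (sizeDist s n) a) :
    welfareLaw proportionalRep s a n = signedLaw (propCosine s n a) := by
  have hpos := fun i => (hs i).1
  have hB := sum_sq_weight_pos hs ha
  have hc := propCosine_mem hs ha
  refine welfareLaw_eq_signedLaw (h := fun x => x) measurable_id'
    (p := fun i : Fin n => √(s i) / √(∑ i : Fin n, s i))
    (q := fun i : Fin n => a (s i) / √(s i) / √(∑ i : Fin n, (a (s i) / √(s i)) ^ 2))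
    (τ := √(∑ i : Fin n, (a (s i) / √(s i)) ^ 2))
    ⟨Real.sqrt_pos.2 hB, margin_div_sd_eq hpos _ _, fun ω => ?_⟩ hc
    (map_weightedPair_id ?_ (sum_div_sqrt_sq _ hB) (propCosine_eq_sum hpos).symm hc)
  · have := (Real.sqrt_pos.2 hB).ne'
    rw [weightedPair_im, totalWeightMargin, Finset.mul_sum]
    refine Finset.sum_congr rfl fun i _ => ?_
    rw [proportionalRep, voteMargin]
    generalize √(∑ i : Fin n, (a (s i) / √(s i)) ^ 2) = τ at this ⊢
    field_simp
  · have := sum_div_sqrt_sq (S := Finset.univ) (fun i : Fin n => √(s i))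
      (by rw [sum_sq_sqrt_size hpos]; exact sum_size_pos hpos)
    rwa [sum_sq_sqrt_size hpos] at this

end PropRep

/-! ### Winner-take-all -/

lemma sign_div_sqrt {x y : ℝ} (hy : 0 < y) : Real.sign (x / √y) = Real.sign x := by
  have hy' := Real.sqrt_pos.2 hy
  rcases lt_trichotomy x 0 with h | rfl | h
  · rw [Real.sign_of_neg h, Real.sign_of_neg (div_neg_of_neg_of_pos h hy')]
  · simp
  · rw [Real.sign_of_pos h, Real.sign_of_pos (div_pos h hy')]

/-- Eventually `b n ≥ (β / 2) * n`, which gives the uniform smallness required by the central limit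
theorem. -/
lemma eventually_abs_div_sqrt_le {b : ℕ → ℝ} {β K : ℝ} (hβ : 0 < β)
    (hb : Tendsto (fun n : ℕ => (n : ℝ)⁻¹ * b n) atTop (𝓝 β)) {x : ℕ → ℝ}
    (hx : ∀ i, |x i| ≤ K) :
    ∀ᶠ n : ℕ in atTop, ∀ i, |x i / √(b n)| ≤ K / √(β / 2) / √n := by
  have hK : 0 ≤ K := (abs_nonneg _).trans (hx 0)
  filter_upwards [hb.eventually (lt_mem_nhds (half_lt_self hβ)), eventually_gt_atTop 0]
    with n hn hn0 i
  have hn0' : (0 : ℝ) < n := by exact_mod_cast hn0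
  have h1 : β / 2 * n ≤ b n := by
    rw [inv_mul_eq_div, lt_div_iff₀ hn0'] at hn
    exact hn.le
  rw [abs_div, abs_of_nonneg (Real.sqrt_nonneg _), div_div, ← Real.sqrt_mul (by positivity)]
  exact div_le_div₀ hK (hx i) (Real.sqrt_pos.2 (by positivity)) (Real.sqrt_le_sqrt h1)

lemma eventually_sum_div_sqrt_sq {b : ℕ → ℝ} {β : ℝ} (hβ : 0 < β) {x : ℕ → ℝ}
    (hbx : ∀ n, b n = ∑ i : Fin n, x i ^ 2)
    (hb : Tendsto (fun n : ℕ => (n : ℝ)⁻¹ * b n) atTop (𝓝 β)) :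
    ∀ᶠ n : ℕ in atTop, 0 < b n ∧ ∑ i : Fin n, (x i / √(b n)) ^ 2 = 1 := by
  filter_upwards [hb.eventually (lt_mem_nhds hβ), eventually_gt_atTop 0] with n hn hn0
  have hn0' : (0 : ℝ) < (n : ℝ)⁻¹ := by positivity
  have hpos : 0 < b n := pos_of_mul_pos_right hn hn0'.le
  refine ⟨hpos, ?_⟩
  rw [hbx] at hpos ⊢
  exact sum_div_sqrt_sq _ hpos

section WinnerTakeAll

variable {sbar abar : ℝ} {s : ℕ → ℝ} {Ψ : ProbabilityMeasure ℝ} {a : ℝ → ℝ}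

lemma IsWeightAllocation.measurable_indicator {μ : Measure ℝ}
    (ha : IsWeightAllocation sbar abar μ a) : Measurable ((Icc 0 sbar).indicator a) := by
  refine measurable_of_restrict_of_restrict_compl (s := Icc 0 sbar) measurableSet_Icc ?_ ?_
  · convert ha.measurable using 1
    ext x
    simp
  · convert measurable_const (a := (0 : ℝ)) using 1
    ext x
    exact indicator_of_notMem x.2 a

/-- A nonnegative variable with mean zero vanishes almost surely, which would make `Ψ` degenerate at
0. -/
lemma integral_size_pos (hs : ∀ i, s i ∈ Ioc 0 sbar)
    (hΨ : Tendsto (fun n : ℕ => sizeDist s (n + 1)) atTop (𝓝 Ψ))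
    (h0 : (Ψ : Measure ℝ) ≠ Measure.dirac 0) : 0 < ∫ x : ℝ, x ∂Ψ := by
  have hmem : ∀ᵐ x ∂(Ψ : Measure ℝ), x ∈ Icc 0 sbar :=
    ae_mem_of_tendsto_sizeDist hΨ isClosed_Icc fun i => Ioc_subset_Icc_self (hs i)
  have hnn : 0 ≤ᵐ[(Ψ : Measure ℝ)] fun x : ℝ => x := hmem.mono fun x hx => hx.1
  have hi : Integrable (fun x : ℝ => x) (Ψ : Measure ℝ) :=
    Integrable.of_bound (C := sbar) (by fun_prop)
      (hmem.mono fun x hx => by rw [Real.norm_eq_abs, abs_of_nonneg hx.1]; exact hx.2)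
  refine lt_of_le_of_ne (integral_nonneg_of_ae hnn) fun h => h0 ?_
  have hz := (integral_eq_zero_iff_of_nonneg_ae hnn hi).1 h.symm
  have : (Ψ : Measure ℝ).map (fun x => x) = (Ψ : Measure ℝ).map fun _ => (0 : ℝ) :=
    Measure.map_congr hz
  simpa [Measure.map_const] using this

lemma integral_weight_sq_pos (hs : ∀ i, s i ∈ Ioc 0 sbar)
    (hΨ : Tendsto (fun n : ℕ => sizeDist s (n + 1)) atTop (𝓝 Ψ))
    (ha : IsWeightAllocation sbar abar Ψ a) : 0 < ∫ x, a x ^ 2 ∂Ψ := by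
  have hmem : ∀ᵐ x ∂(Ψ : Measure ℝ), x ∈ Icc 0 sbar :=
    ae_mem_of_tendsto_sizeDist hΨ isClosed_Icc fun i => Ioc_subset_Icc_self (hs i)
  have hnn : 0 ≤ᵐ[(Ψ : Measure ℝ)] fun x => a x ^ 2 := ae_of_all _ fun x => sq_nonneg _
  have hae : (Icc 0 sbar).indicator a =ᵐ[(Ψ : Measure ℝ)] a :=
    hmem.mono fun x hx => indicator_of_mem hx a
  have hi : Integrable (fun x => a x ^ 2) (Ψ : Measure ℝ) := by
    refine Integrable.of_bound (C := abar ^ 2)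
      (ha.measurable_indicator.aestronglyMeasurable.congr hae |>.pow 2)
      (hmem.mono fun x hx => ?_)
    have := ha.mapsTo hx
    rw [Real.norm_eq_abs, abs_of_nonneg (sq_nonneg _)]
    exact pow_le_pow_left₀ this.1 this.2 2
  refine lt_of_le_of_ne (integral_nonneg_of_ae hnn) fun h => ha.not_ae_zero ?_
  filter_upwards [(integral_eq_zero_iff_of_nonneg_ae hnn hi).1 h.symm] with x hx
  exact pow_eq_zero_iff two_ne_zero |>.1 hx

theorem isLimitWelfareLaw_winnerTakeAll (hs : ∀ i, s i ∈ Ioc 0 sbar)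
    (hΨ : Tendsto (fun n : ℕ => sizeDist s (n + 1)) atTop (𝓝 Ψ))
    (h0 : (Ψ : Measure ℝ) ≠ Measure.dirac 0) (ha : IsWeightAllocation sbar abar Ψ a)
    (hac : AEContinuousAlong s Ψ a) :
    absMoment * asympSqrtCosine Ψ a ∈ Icc (0 : ℝ) 1 ∧
      IsLimitWelfareLaw winnerTakeAll s a
        (signedProb (absMoment * asympSqrtCosine Ψ a)) := by
  have hpos := fun i => (hs i).1
  have haI := fun i => ha.mapsTo (Ioc_subset_Icc_self (hs i))
  have hA := integral_size_pos hs hΨ h0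
  have hB := integral_weight_sq_pos hs hΨ ha
  have hind := ha.measurable_indicator
  have tA : Tendsto (fun n : ℕ => (n : ℝ)⁻¹ * ∑ i : Fin n, s i) atTop (𝓝 (∫ x : ℝ, x ∂Ψ)) :=
    tendsto_average hs hΨ (h := fun x => x) (measurable_id.indicator measurableSet_Icc)
      (ae_of_all _ fun x => continuousWithinAt_id) (B := sbar)
      fun x hx => by rw [abs_of_nonneg hx.1]; exact hx.2
  have tB : Tendsto (fun n : ℕ => (n : ℝ)⁻¹ * ∑ i : Fin n, a (s i) ^ 2) atTop
      (𝓝 (∫ x, a x ^ 2 ∂Ψ)) := by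
    refine tendsto_average hs hΨ (h := fun x => a x ^ 2) ?_ (hac.mono fun x hx => hx.pow 2)
      (B := abar ^ 2) fun x hx => ?_
    · convert hind.pow_const 2 using 1
      ext x
      by_cases hx : x ∈ Icc 0 sbar
      · simp only [indicator_of_mem hx]
      · simp only [indicator_of_notMem hx]; simp
    · have := ha.mapsTo hx
      rw [abs_of_nonneg (sq_nonneg _)]
      exact pow_le_pow_left₀ this.1 this.2 2
  have tC : Tendsto (fun n : ℕ => (n : ℝ)⁻¹ * ∑ i : Fin n, √(s i) * a (s i)) atTop
      (𝓝 (∫ x, √x * a x ∂Ψ)) := by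
    refine tendsto_average hs hΨ (h := fun x => √x * a x) ?_
      (hac.mono fun x hx => Real.continuous_sqrt.continuousWithinAt.mul hx)
      (B := √sbar * abar) fun x hx => ?_
    · convert Real.continuous_sqrt.measurable.mul hind using 1
      ext x
      by_cases hx : x ∈ Icc 0 sbar
      · simp only [indicator_of_mem hx, Pi.mul_apply]
      · simp only [indicator_of_notMem hx, Pi.mul_apply, mul_zero]
    · have := ha.mapsTo hx
      rw [abs_mul, abs_of_nonneg (Real.sqrt_nonneg _), abs_of_nonneg this.1]
      exact mul_le_mul (Real.sqrt_le_sqrt hx.2) this.2 this.1 (Real.sqrt_nonneg _)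
  let p : ∀ n : ℕ, Fin n → ℝ := fun n i => √(s i) / √(∑ i : Fin n, s i)
  let q : ∀ n : ℕ, Fin n → ℝ := fun n i => a (s i) / √(∑ i : Fin n, a (s i) ^ 2)
  have hp1 := eventually_sum_div_sqrt_sq (x := fun i => √(s i)) hA
    (fun n => Finset.sum_congr rfl fun i _ => (Real.sq_sqrt (hpos i).le).symm) tA
  have hq1 := eventually_sum_div_sqrt_sq (x := fun i => a (s i)) hB (fun n => rfl) tB
  -- The factors `n⁻¹` in numerator and denominator cancel, so the quotient of the averages is the
  -- finite-`n` cosine.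
  have tpq : Tendsto (fun n => ∑ i, p n i * q n i) atTop (𝓝 (asympSqrtCosine Ψ a)) := by
    rw [asympSqrtCosine, Real.sqrt_mul hA.le]
    refine (tC.div (tA.sqrt.mul tB.sqrt)
      (mul_pos (Real.sqrt_pos.2 hA) (Real.sqrt_pos.2 hB)).ne').congr' ?_
    filter_upwards [hp1, hq1, eventually_gt_atTop 0] with n hpn hqn hn
    have hn' : (0 : ℝ) < n := by exact_mod_cast hn
    have e : √((n : ℝ)⁻¹) * √((n : ℝ)⁻¹) = (n : ℝ)⁻¹ := Real.mul_self_sqrt (by positivity)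
    have h1 := (Real.sqrt_pos.2 hpn.1).ne'
    have h2 := (Real.sqrt_pos.2 hqn.1).ne'
    rw [Pi.div_apply, Real.sqrt_mul (by positivity), Real.sqrt_mul (by positivity),
      mul_mul_mul_comm, e,
      mul_div_mul_left _ _ (by positivity), Finset.sum_div]
    exact Finset.sum_congr rfl fun i _ => (div_mul_div_comm _ _ _ _).symm
  -- The bound by 1 holds for the cosines of unit vectors and passes to the limit.
  have hc1 : asympSqrtCosine Ψ a ≤ 1 := le_of_tendsto tpq (by
    filter_upwards [hp1, hq1] with n hpn hqn
    exact sum_mul_le_one hpn.2 hqn.2)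
  have hc0 : 0 ≤ asympSqrtCosine Ψ a := ge_of_tendsto' tpq fun n =>
    Finset.sum_nonneg fun i _ => mul_nonneg (div_nonneg (Real.sqrt_nonneg _) (Real.sqrt_nonneg _))
      (div_nonneg (haI i).1 (Real.sqrt_nonneg _))
  have hc : absMoment * asympSqrtCosine Ψ a ∈ Icc (0 : ℝ) 1 :=
    ⟨mul_nonneg absMoment_pos.le hc0, mul_le_one₀ absMoment_le_one hc0 hc1⟩
  refine ⟨hc, ?_⟩
  set L := max (√sbar / √((∫ x : ℝ, x ∂Ψ) / 2)) (abar / √((∫ x, a x ^ 2 ∂Ψ) / 2)) with hL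
  have hpL : ∀ᶠ n in atTop, ∀ i, |p n i| ≤ L / √n := by
    filter_upwards [eventually_abs_div_sqrt_le (K := √sbar) (x := fun i => √(s i)) hA tA
      fun i => by rw [abs_of_nonneg (Real.sqrt_nonneg _)]; exact Real.sqrt_le_sqrt (hs i).2]
      with n hn i
    exact (hn i).trans (div_le_div_of_nonneg_right (le_max_left _ _) (Real.sqrt_nonneg _))
  have hqL : ∀ᶠ n in atTop, ∀ i, |q n i| ≤ L / √n := by
    filter_upwards [eventually_abs_div_sqrt_le (K := abar) (x := fun i => a (s i)) hB tB
      fun i => by rw [abs_of_nonneg (haI i).1]; exact (haI i).2] with n hn i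
    exact (hn i).trans (div_le_div_of_nonneg_right (le_max_right _ _) (Real.sqrt_nonneg _))
  refine isLimitWelfareLaw_of_tendsto_charFun (r := winnerTakeAll) measurable_sign
    measurable_sign (p := p) (q := q)
    (τ := fun n => √(∑ i : Fin n, a (s i) ^ 2)) ?_ hc
    (tendsto_charFun_weightedPair_sign p q hpL hqL
      (tendsto_const_nhds.congr' (hp1.mono fun n hn => hn.2.symm))
      (tendsto_const_nhds.congr' (hq1.mono fun n hn => hn.2.symm)) tpq hc)
  filter_upwards [hq1] with n hqn
  refine ⟨Real.sqrt_pos.2 hqn.1, margin_div_sd_eq hpos _ _, fun ω => ?_⟩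
  have := (Real.sqrt_pos.2 hqn.1).ne'
  rw [weightedPair_im, totalWeightMargin, Finset.mul_sum]
  refine Finset.sum_congr rfl fun i _ => ?_
  rw [winnerTakeAll, voteMargin, sign_div_sqrt (hpos i)]
  simp only [q]
  generalize √(∑ i : Fin n, a (s i) ^ 2) = τ at this ⊢
  field_simp

end WinnerTakeAll

/-- `AsympWelfareGE` only asserts that some limit laws are ordered; uniqueness identifies them with
the computed ones. -/
lemma IsLimitWelfareLaw.unique {r : ℝ → ℝ} {s : ℕ → ℝ} {a : ℝ → ℝ}
    {H H' : ProbabilityMeasure ℝ} (h : IsLimitWelfareLaw r s a H)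
    (h' : IsLimitWelfareLaw r s a H') : (H : Measure ℝ) = H' := by
  simpa using tendstoInDistribution_unique _ h h'

end VotingWelfare

end

theorem theorem2 (sbar abar : ℝ) (s : ℕ → ℝ) (hs : ∀ i, s i ∈ Set.Ioc 0 sbar) :
    -- (i) winner-take-all, as the number of groups tends to infinity
    (∀ Ψ : ProbabilityMeasure ℝ,
      Tendsto (fun n : ℕ => VotingWelfare.sizeDist s (n + 1)) atTop (𝓝 Ψ) →
      (Ψ : Measure ℝ) ≠ Measure.dirac 0 →
      (∀ a : ℝ → ℝ, VotingWelfare.IsWeightAllocation sbar abar Ψ a →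
        VotingWelfare.AEContinuousAlong s Ψ a →
        ∃ H : ProbabilityMeasure ℝ,
          VotingWelfare.IsLimitWelfareLaw VotingWelfare.winnerTakeAll s a H ∧
          ∀ x : ℝ, (H : Measure ℝ) ≠ Measure.dirac x) ∧
      (∀ a b : ℝ → ℝ, VotingWelfare.IsWeightAllocation sbar abar Ψ a →
        VotingWelfare.AEContinuousAlong s Ψ a →
        VotingWelfare.IsWeightAllocation sbar abar Ψ b →
        VotingWelfare.AEContinuousAlong s Ψ b →
        (VotingWelfare.AsympWelfareGE VotingWelfare.winnerTakeAll s a b ↔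
          VotingWelfare.asympSqrtCosine Ψ a ≥ VotingWelfare.asympSqrtCosine Ψ b))) ∧
    -- (ii) proportional representation, for every number of groups
    (∀ (n : ℕ) [NeZero n],
      (∀ a : ℝ → ℝ, VotingWelfare.IsWeightAllocation sbar abar (VotingWelfare.sizeDist s n) a →
        (VotingWelfare.propCosine s n a ≠ 1 →
          VotingWelfare.welfareLaw VotingWelfare.proportionalRep s a n =
            VotingWelfare.skewNormal (VotingWelfare.propCosine s n a /
              √(1 - VotingWelfare.propCosine s n a ^ 2))) ∧
        (VotingWelfare.propCosine s n a = 1 →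
          VotingWelfare.welfareLaw VotingWelfare.proportionalRep s a n =
            VotingWelfare.halfNormal)) ∧
      (∀ a b : ℝ → ℝ,
        VotingWelfare.IsWeightAllocation sbar abar (VotingWelfare.sizeDist s n) a →
        VotingWelfare.IsWeightAllocation sbar abar (VotingWelfare.sizeDist s n) b →
        (VotingWelfare.WelfareGE VotingWelfare.proportionalRep s n a b ↔
          VotingWelfare.propCosine s n a ≥ VotingWelfare.propCosine s n b))) := by
  refine ⟨fun Ψ hΨ h0 => ⟨fun a ha hac => ?_, fun a b ha hac hb hbc => ?_⟩, fun n _ =>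
    ⟨fun a ha => ?_, fun a b ha hb => ?_⟩⟩
  · obtain ⟨hc, hlim⟩ := VotingWelfare.isLimitWelfareLaw_winnerTakeAll hs hΨ h0 ha hac
    exact ⟨_, hlim, VotingWelfare.signedLaw_ne_dirac hc⟩
  · obtain ⟨hca, hla⟩ := VotingWelfare.isLimitWelfareLaw_winnerTakeAll hs hΨ h0 ha hac
    obtain ⟨hcb, hlb⟩ := VotingWelfare.isLimitWelfareLaw_winnerTakeAll hs hΨ h0 hb hbc
    -- The correlations are the indices times the positive factor `absMoment`, so the comparison is
    -- unchanged.
    rw [ge_iff_le, ← mul_le_mul_iff_right₀ VotingWelfare.absMoment_pos,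
      ← VotingWelfare.signedLaw_dominates_iff hcb hca]
    constructor
    · rintro ⟨Ha, Hb, hHa, hHb, hdom⟩
      rw [hHa.unique hla, hHb.unique hlb] at hdom
      exact hdom
    · exact fun hdom => ⟨_, _, hla, hlb, hdom⟩
  · have hc := VotingWelfare.propCosine_mem hs ha
    rw [VotingWelfare.welfareLaw_proportionalRep hs ha]
    refine ⟨fun h => ?_, fun h => ?_⟩
    · exact VotingWelfare.signedLaw_eq_skewNormal hc.1 (lt_of_le_of_ne hc.2 h)
    · rw [h, VotingWelfare.signedLaw_one]
  · rw [VotingWelfare.WelfareGE, VotingWelfare.welfareLaw_proportionalRep hs ha,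
      VotingWelfare.welfareLaw_proportionalRep hs hb, ge_iff_le]
    exact VotingWelfare.signedLaw_dominates_iff (VotingWelfare.propCosine_mem hs hb)
      (VotingWelfare.propCosine_mem hs ha)
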